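/- **Definitions.** Call two real-valued functions, each defined and smooth on a half-line $(u,\infty)$ with $u\in\mathbb R\cup\{-\infty\}$ (which may depend on the function), equivalent if they agree for all sufficiently large arguments; the equivalence classes (germs at infinity) form a ring under pointwise addition and multiplication. A *Hardy field* is a subfield of this ring that is closed under differentiation, and a *Hardy field function* is a smooth function $h:(u,\infty)\to\mathbb R$ whose germ belongs to some Hardy field. Its *growth rate* is $\inf\{\alpha\in\mathbb R : |h(t)|\le t^{\alpha}\text{ for all sufficiently large }t\}$. For a set $S$ of integers and a positive integer $N$, let $\gamma_S(N)$ be the infimum of the constant coefficients $a_0$ over all real cosine polynomials $$T(\xi)=a_0+\sum_{k=1}^{K}a_k\cos(2\pi k\xi),\qquad K\ge 0,$$ such that $T(\xi)\ge 0$ for all $\xi\in\mathbb R$, $T(0)=1$, and $a_k=0$ for every $k\ge 1$ with $k\notin S\cap\{1,\dots,N\}$. **Theorem.** Let $h:(u,\infty)\to\mathbb R$ be a Hardy field function with growth rate $c$, where $1<c<\tfrac65$, and let $$S_h=\{\pm\lfloor h(n)\rfloor : n\in\mathbb N,\ n>u\}.$$ Then for every $\varepsilon>0$ there is a constant $C=C(h,\varepsilon)>0$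 such that for all integers $N\ge 1$ $$\gamma_{S_h}(N)\le C\,N^{-\left(\frac{6}{5c}-1\right)+\varepsilon}.$$ Consequently, for every $\varepsilon>0$ there is a constant $C'=C'(h,\varepsilon)>0$ such that for all integers $N\ge1$ the following holds: if $A\subseteq\{1,\dots,N\}$ contains no pair $\{x,x+\lfloor h(n)\rfloor\}$ and no pair $\{x,x-\lfloor h(n)\rfloor\}$ with $n\in\mathbb N$, $n>u$ and $\lfloor h(n)\rfloor\ne 0$, then $$|A|\le C'\,N^{1-\left(\frac{6}{5c}-1\right)+\varepsilon}.$$ -/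

import Mathlib

open Filter
open scoped ContDiff

/-- A *Hardy field*: a subfield of the ring of germs at `+∞` of smooth real functions which is
closed under differentiation. A germ is smooth when a representative (equivalently, every
representative) is smooth on some half-line `(T, ∞)`. -/
structure IsHardyField (F : Subring (Germ (atTop : Filter ℝ) ℝ)) : Prop where
  smooth : ∀ f : ℝ → ℝ, (f : Germ (atTop : Filter ℝ) ℝ) ∈ F →
    ∃ T : ℝ, ContDiffOn ℝ ∞ f (Set.Ioi T)
  isField : IsField F
  deriv_mem : ∀ f : ℝ → ℝ, (f : Germ (atTop : Filter ℝ) ℝ) ∈ F →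
    ((deriv f : ℝ → ℝ) : Germ (atTop : Filter ℝ) ℝ) ∈ F

/-- `h` is a *Hardy field function* on `(u, ∞)`, where `u ∈ ℝ ∪ {-∞}`: it is smooth on `(u, ∞)`
and its germ at infinity belongs to some Hardy field. The values of `h` outside `(u, ∞)` are
irrelevant. -/
def IsHardyFieldFunction (u : WithBot ℝ) (h : ℝ → ℝ) : Prop :=
  ContDiffOn ℝ ∞ h {t : ℝ | u < (t : WithBot ℝ)} ∧
    ∃ F : Subring (Germ (atTop : Filter ℝ) ℝ),
      IsHardyField F ∧ (h : Germ (atTop : Filter ℝ) ℝ) ∈ F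

/-- `h` has *growth rate* `c`: `c` is the infimum of the real exponents `α` such that
`|h t| ≤ t ^ α` for all sufficiently large `t`. -/
def HasGrowthRate (h : ℝ → ℝ) (c : ℝ) : Prop :=
  IsGLB {α : ℝ | ∀ᶠ t : ℝ in atTop, |h t| ≤ t ^ α} c

/-- The set `S_h = {± ⌊h n⌋ : n ∈ ℕ}`, where `n` runs over the natural numbers in the domain
`(u, ∞)` of `h`. -/
def floorSet (u : WithBot ℝ) (h : ℝ → ℝ) : Set ℤ :=
  {s : ℤ | ∃ n : ℕ, u < ((n : ℝ) : WithBot ℝ) ∧ (s = ⌊h n⌋ ∨ s = -⌊h n⌋)}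

/-- The cosine polynomial `a₀ + ∑_{k = 1}^{K} a_k cos (2 π k ξ)`. -/
noncomputable def cosPoly (K : ℕ) (a : ℕ → ℝ) (ξ : ℝ) : ℝ :=
  a 0 + ∑ k ∈ Finset.Icc 1 K, a k * Real.cos (2 * Real.pi * k * ξ)

/-- The class `𝒯_S`: non-negative cosine polynomials `T` with `T 0 = 1`, whose coefficients `a_k`,
`k ≥ 1`, are supported on `S`. -/
structure IsVdCPolynomial (S : Set ℤ) (K : ℕ) (a : ℕ → ℝ) : Prop where
  nonneg : ∀ ξ : ℝ, 0 ≤ cosPoly K a ξ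
  eval_zero : cosPoly K a 0 = 1
  support : ∀ k ∈ Finset.Icc 1 K, (k : ℤ) ∉ S → a k = 0

/-- The Van der Corput quantity `γ_S(N)`: the infimum of the constant coefficients `a₀` of the
members of `𝒯_{S ∩ {1, …, N}}`. -/
noncomputable def vdcQuantity (S : Set ℤ) (N : ℕ) : ℝ :=
  sInf {x : ℝ | ∃ (K : ℕ) (a : ℕ → ℝ), IsVdCPolynomial (S ∩ Set.Icc 1 (N : ℤ)) K a ∧ a 0 = x}

/-- The constant coefficient of a member of `𝒯_S` is non-negative, being the mean of `T`; so the
infimum in `vdcQuantity` is over a set that is bounded below. -/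
theorem IsVdCPolynomial.coeff_zero_nonneg {S : Set ℤ} {K : ℕ} {a : ℕ → ℝ}
    (h : IsVdCPolynomial S K a) : 0 ≤ a 0 := by
  have h1 : ∫ ξ in (0 : ℝ)..1, cosPoly K a ξ = a 0 := by
    unfold cosPoly
    rw [intervalIntegral.integral_add (by simp)
      (Continuous.intervalIntegrable (by fun_prop) _ _),
      intervalIntegral.integral_finsetSum
        (fun k _ => Continuous.intervalIntegrable (by fun_prop) _ _)]
    have h2 : ∀ k ∈ Finset.Icc 1 K,
        ∫ ξ in (0 : ℝ)..1, a k * Real.cos (2 * Real.pi * k * ξ) = 0 := by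
      intro k hk
      have hk0 : (k : ℝ) ≠ 0 := by
        have := (Finset.mem_Icc.1 hk).1
        positivity
      have hs : Real.sin (2 * Real.pi * k) = 0 := by
        have := Real.sin_nat_mul_pi (2 * k)
        push_cast at this
        rw [← this]
        ring_nf
      have hne : 2 * Real.pi * k ≠ 0 := by positivity
      rw [intervalIntegral.integral_const_mul,
        intervalIntegral.integral_comp_mul_left (fun x => Real.cos x) hne]
      simp [hs]
    rw [Finset.sum_eq_zero h2]
    simp
  rw [← h1]
  exact intervalIntegral.integral_nonneg (by norm_num) (fun ξ _ => h.nonneg ξ)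

/-- The constant polynomial `1` belongs to every class `𝒯_S`; so the infimum in `vdcQuantity` is
over a non-empty set. -/
theorem isVdCPolynomial_one (S : Set ℤ) : IsVdCPolynomial S 0 (fun _ => 1) :=
  ⟨by simp [cosPoly], by simp [cosPoly], by simp⟩

/-! The bound on |A| is Van der Corput duality (`IsVdCPolynomial.card_le`): averaging T against the
power spectrum of A over the multiples of 1/(2N) shows |A| ≤ 2N·a₀. The work lies in constructing a
good T.

Up to sign, h is a function f with regular derivatives f', f''. Put X = r⁵, Y = f(X), D = f'(X), and
consider the sum over r² ≤ n < X of w(n) sin²(π f(n)) cos(2π⌊f(n)⌋ξ), where w(t) = (1 - f(t)/Y)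
f'(t). If this sum may be replaced by an integral, the substitution y = f(t) turns it into a
triangular average of sin²(πy) e(ξ⌊y⌋). On unit cells that average is half a Fejér-type sum, so its
real part is at least -5/4 (`neg_le_sum_triangle_cos`), while its value at ξ = 0 is at least Y/4 ≥
XD/16. If the replacement costs at most E, adding about E as constant term and normalising gives a₀
of order E/(XD) (`vdcQuantity_le_of_sum_cos_ge`).

The factor sin² makes the floor exponential continuous. Its expansion in e((ξ+k)y) has cubically
decaying coefficients (`norm_floorWaveCoeff_mul_le`), so an error that grows linearly in the
frequency θ is affordable.

For one frequency, [r², r⁵) is cut into blocks of length L on which θf is nearly linear. The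
geometric sum on a block is within O(1/ρ) of its integral unless θf' at the start of the block is
within ρ of a non-zero integer. Since f' increases at a controlled rate, few blocks are that close
(`card_bad_blocks_le`), and those are estimated trivially. With L = r² and ρ = 1/r the error is of
order (1 + |θ|) r⁴D² (`exists_norm_sum_wave_sub_integral_le`). Hence a₀ is of order D/r, roughly
X^(c - 6/5), and N is roughly X^c, which gives the exponent 6/(5c) - 1. -/

/-! ### Duality: cosine polynomials bound sets that avoid differences. -/

theorem sum_range_cos_two_pi_div (M : ℕ) (hM : 0 < M) (d : ℤ) :
    ∑ j ∈ Finset.range M, Real.cos (2 * Real.pi * d * (j / M)) =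
      if (M : ℤ) ∣ d then (M : ℝ) else 0 := by
  have hM0 : (M : ℝ) ≠ 0 := by positivity
  split_ifs with hd
  · obtain ⟨e, rfl⟩ := hd
    have : ∀ j ∈ Finset.range M,
        Real.cos (2 * Real.pi * ((M * e : ℤ) : ℝ) * (j / M)) = 1 := by
      intro j _
      rw [Real.cos_eq_one_iff]
      refine ⟨e * j, ?_⟩
      push_cast
      field_simp
    rw [Finset.sum_congr rfl this]
    simp
  · set z : ℂ := Complex.exp (2 * Real.pi * d / M * Complex.I) with hz
    have hM1 : (M : ℂ) ≠ 0 := by exact_mod_cast hM0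
    have hz1 : z ≠ 1 := by
      intro h1
      rw [hz, Complex.exp_eq_one_iff] at h1
      obtain ⟨n, hn⟩ := h1
      apply hd
      refine ⟨n, ?_⟩
      have hpi : (Real.pi : ℂ) ≠ 0 := by exact_mod_cast Real.pi_ne_zero
      have hI := Complex.I_ne_zero
      field_simp at hn
      have : (d : ℂ) = M * n := by
        rw [hn]
      exact_mod_cast this
    have hzM : z ^ M = 1 := by
      rw [hz, ← Complex.exp_nat_mul, Complex.exp_eq_one_iff]
      exact ⟨d, by field_simp⟩
    have hgeom : ∑ j ∈ Finset.range M, z ^ j = 0 := by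
      rw [geom_sum_eq hz1, hzM]; simp
    have hre := congrArg Complex.re hgeom
    rw [Complex.re_sum] at hre
    rw [Complex.zero_re] at hre
    rw [← hre]
    refine Finset.sum_congr rfl fun j _ => ?_
    rw [hz, ← Complex.exp_nat_mul]
    have : (j : ℂ) * (2 * Real.pi * d / M * Complex.I) =
        ((2 * Real.pi * d * (j / M) : ℝ) : ℂ) * Complex.I := by
      push_cast; ring
    rw [this, Complex.exp_ofReal_mul_I_re]

theorem sum_range_cos_mul_cos_eq_zero (M : ℕ) (hM : 0 < M) (k d : ℤ)
    (h1 : ¬ (M : ℤ) ∣ d + k) (h2 : ¬ (M : ℤ) ∣ d - k) :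
    ∑ j ∈ Finset.range M,
      Real.cos (2 * Real.pi * k * (j / M)) * Real.cos (2 * Real.pi * d * (j / M)) = 0 := by
  have a1 := sum_range_cos_two_pi_div M hM (d + k)
  have a2 := sum_range_cos_two_pi_div M hM (d - k)
  rw [if_neg h1] at a1
  rw [if_neg h2] at a2
  have : ∀ j ∈ Finset.range M,
      Real.cos (2 * Real.pi * k * (j / M)) * Real.cos (2 * Real.pi * d * (j / M)) =
      (Real.cos (2 * Real.pi * ((d + k : ℤ) : ℝ) * (j / M)) +
       Real.cos (2 * Real.pi * ((d - k : ℤ) : ℝ) * (j / M))) / 2 := by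
    intro j _
    have e1 : 2 * Real.pi * ((d + k : ℤ) : ℝ) * (j / M) =
      2 * Real.pi * d * (j / M) + 2 * Real.pi * k * (j / M) := by push_cast; ring
    have e2 : 2 * Real.pi * ((d - k : ℤ) : ℝ) * (j / M) =
      2 * Real.pi * d * (j / M) - 2 * Real.pi * k * (j / M) := by push_cast; ring
    rw [e1, e2, Real.cos_add, Real.cos_sub]; ring
  rw [Finset.sum_congr rfl this, ← Finset.sum_div, Finset.sum_add_distrib, a1, a2]
  simp

theorem sum_sum_cos_sub (A : Finset ℤ) (ξ : ℝ) :
    ∑ x ∈ A, ∑ y ∈ A, Real.cos (2 * Real.pi * ((x - y : ℤ) : ℝ) * ξ) =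
      (∑ x ∈ A, Real.cos (2 * Real.pi * x * ξ)) ^ 2 +
      (∑ x ∈ A, Real.sin (2 * Real.pi * x * ξ)) ^ 2 := by
  rw [sq, sq, Finset.sum_mul_sum, Finset.sum_mul_sum, ← Finset.sum_add_distrib]
  refine Finset.sum_congr rfl fun x _ => ?_
  rw [← Finset.sum_add_distrib]
  refine Finset.sum_congr rfl fun y _ => ?_
  rw [← Real.cos_sub]
  congr 1; push_cast; ring

/-- Sum T(ξ)·|∑ e(xξ)|² over the 2N-th fractions ξ = j/(2N). The term j = 0 alone is |A|². By
orthogonality the frequencies in S contribute nothing, since A has no such difference, and the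
constant term contributes a₀·2N·|A|. -/
theorem IsVdCPolynomial.card_le {S : Set ℤ} {N K : ℕ} {a : ℕ → ℝ} (hN : 1 ≤ N)
    (ha : IsVdCPolynomial (S ∩ Set.Icc 1 (N : ℤ)) K a) {A : Finset ℤ}
    (hA : A ⊆ Finset.Icc 1 (N : ℤ))
    (hS : ∀ k ∈ S, 1 ≤ k → ∀ x ∈ A, x + k ∉ A ∧ x - k ∉ A) :
    (A.card : ℝ) ≤ 2 * N * a 0 := by
  rcases A.eq_empty_or_nonempty with rfl | hne
  · have := ha.coeff_zero_nonneg
    simp; positivity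
  -- Both |x - y| ≤ N - 1 and k ≤ N, so x - y ± k is smaller than 2N in absolute value. Divisibility
  -- by 2N therefore means vanishing: there is no wrap-around.
  set M : ℕ := 2 * N with hM
  have hMpos : 0 < M := by omega
  have hM0 : (M : ℝ) ≠ 0 := by positivity
  set P : ℝ → ℝ := fun ξ => ∑ x ∈ A, ∑ y ∈ A, Real.cos (2 * Real.pi * ((x - y : ℤ) : ℝ) * ξ)
    with hP
  have hPnn : ∀ ξ, 0 ≤ P ξ := fun ξ => by
    simp only [hP]; rw [sum_sum_cos_sub]; positivity
  have hP0 : P 0 = (A.card : ℝ) ^ 2 := by simp [hP, sq]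
  have hlower : (A.card : ℝ) ^ 2 ≤ ∑ j ∈ Finset.range M, cosPoly K a (j / M) * P (j / M) := by
    have := Finset.single_le_sum (f := fun j : ℕ => cosPoly K a (j / M) * P (j / M))
      (s := Finset.range M) (fun j _ => mul_nonneg (ha.nonneg _) (hPnn _))
      (Finset.mem_range.2 hMpos)
    simpa [ha.eval_zero, hP0] using this
  have hbd : ∀ x ∈ A, 1 ≤ x ∧ x ≤ N := fun x hx => Finset.mem_Icc.1 (hA hx)
  have hconst : ∑ j ∈ Finset.range M, P (j / M) = M * A.card := by
    simp only [hP]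
    rw [Finset.sum_comm]
    have : ∀ x ∈ A, ∑ j ∈ Finset.range M, ∑ y ∈ A,
        Real.cos (2 * Real.pi * ((x - y : ℤ) : ℝ) * (j / M)) = M := by
      intro x hx
      rw [Finset.sum_comm]
      rw [Finset.sum_eq_single_of_mem x hx]
      · rw [sum_range_cos_two_pi_div M hMpos]; simp
      · intro y hy hyx
        rw [sum_range_cos_two_pi_div M hMpos, if_neg]
        intro hdvd
        have h1 := hbd x hx
        have h2 := hbd y hy
        have := Int.eq_zero_of_abs_lt_dvd hdvd (by rw [abs_lt]; constructor <;> omega)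
        omega
    rw [Finset.sum_congr rfl this]; simp [mul_comm]
  have hterm : ∀ k ∈ Finset.Icc 1 K, ∑ j ∈ Finset.range M,
      a k * Real.cos (2 * Real.pi * k * (j / M)) * P (j / M) = 0 := by
    intro k hk
    by_cases hkS : (k : ℤ) ∈ S ∩ Set.Icc 1 (N : ℤ)
    · obtain ⟨hkS, hk1, hkN⟩ := hkS
      have : ∀ j ∈ Finset.range M, a k * Real.cos (2 * Real.pi * k * (j / M)) * P (j / M) =
          ∑ x ∈ A, ∑ y ∈ A, a k * (Real.cos (2 * Real.pi * (k : ℤ) * (j / M)) *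
            Real.cos (2 * Real.pi * ((x - y : ℤ) : ℝ) * (j / M))) := by
        intro j _
        simp only [hP, Finset.mul_sum, Int.cast_natCast, mul_assoc]
      rw [Finset.sum_congr rfl this, Finset.sum_comm]
      refine Finset.sum_eq_zero fun x hx => ?_
      rw [Finset.sum_comm]
      refine Finset.sum_eq_zero fun y hy => ?_
      rw [← Finset.mul_sum]
      have h1 := hbd x hx
      have h2 := hbd y hy
      have h3 := hS k hkS hk1 y hy
      rw [sum_range_cos_mul_cos_eq_zero M hMpos, mul_zero]
      · intro hdvd
        have := Int.eq_zero_of_abs_lt_dvd hdvd (by rw [abs_lt]; constructor <;> omega)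
        have e : y - k = x := by omega
        exact h3.2 (e ▸ hx)
      · intro hdvd
        have := Int.eq_zero_of_abs_lt_dvd hdvd (by rw [abs_lt]; constructor <;> omega)
        have e : y + k = x := by omega
        exact h3.1 (e ▸ hx)
    · simp [ha.support k hk hkS]
  have hupper : ∑ j ∈ Finset.range M, cosPoly K a (j / M) * P (j / M) = a 0 * (M * A.card) := by
    have : ∀ j ∈ Finset.range M, cosPoly K a (j / M) * P (j / M) = a 0 * P (j / M) +
        ∑ k ∈ Finset.Icc 1 K, a k * Real.cos (2 * Real.pi * k * (j / M)) * P (j / M) := by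
      intro j _
      rw [cosPoly, add_mul, Finset.sum_mul]
    rw [Finset.sum_congr rfl this, Finset.sum_add_distrib, ← Finset.mul_sum, hconst,
      Finset.sum_comm, Finset.sum_eq_zero hterm, add_zero]
  have hcard : (0 : ℝ) < A.card := by exact_mod_cast hne.card_pos
  rw [hupper] at hlower
  have : (A.card : ℝ) * A.card ≤ (2 * N * a 0) * A.card := by
    have e : (M : ℝ) = 2 * N := by rw [hM]; push_cast; ring
    rw [e] at hlower
    nlinarith
  exact le_of_mul_le_mul_right this hcard

theorem vdcQuantity_le {S : Set ℤ} {N K : ℕ} {a : ℕ → ℝ}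
    (ha : IsVdCPolynomial (S ∩ Set.Icc 1 (N : ℤ)) K a) : vdcQuantity S N ≤ a 0 :=
  csInf_le ⟨0, by rintro x ⟨K, b, hb, rfl⟩; exact hb.coeff_zero_nonneg⟩ ⟨K, a, ha, rfl⟩

theorem vdcQuantity_le_one (S : Set ℤ) (N : ℕ) : vdcQuantity S N ≤ 1 :=
  vdcQuantity_le (isVdCPolynomial_one _)

theorem card_le_two_mul_vdcQuantity {S : Set ℤ} {N : ℕ} (hN : 1 ≤ N) {A : Finset ℤ}
    (hA : A ⊆ Finset.Icc 1 (N : ℤ))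
    (hS : ∀ k ∈ S, 1 ≤ k → ∀ x ∈ A, x + k ∉ A ∧ x - k ∉ A) :
    (A.card : ℝ) ≤ 2 * N * vdcQuantity S N := by
  have hN0 : (0 : ℝ) < 2 * N := by positivity
  rw [← div_le_iff₀' hN0]
  refine le_csInf ⟨1, 0, _, isVdCPolynomial_one _, rfl⟩ ?_
  rintro x ⟨K, a, ha, rfl⟩
  rw [div_le_iff₀' hN0]
  exact ha.card_le hN hA hS

/-- A Fejér kernel written as a sum of cosines is non-negative. -/
theorem fejer_nonneg (M : ℕ) (x : ℝ) :
    0 ≤ (M : ℝ) + 2 * ∑ m ∈ Finset.range M, ((M : ℝ) - (m + 1)) * Real.cos ((m + 1) * x) := by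
  have key : ∀ M : ℕ,
      (M : ℝ) + 2 * ∑ m ∈ Finset.range M, ((M : ℝ) - (m + 1)) * Real.cos ((m + 1) * x) =
      (∑ j ∈ Finset.range M, Real.cos (j * x)) ^ 2 +
        (∑ j ∈ Finset.range M, Real.sin (j * x)) ^ 2 := by
    intro M
    induction M with
    | zero => simp
    | succ M ih =>
      have h1 : ∑ m ∈ Finset.range M, Real.cos ((m + 1) * x) =
          ∑ j ∈ Finset.range M, Real.cos ((M - j) * x) := by
        rw [← Finset.sum_range_reflect]
        refine Finset.sum_congr rfl fun j hj => ?_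
        have : j + 1 ≤ M := Finset.mem_range.1 hj
        rw [show M - 1 - j = M - (j + 1) by omega, Nat.cast_sub this]
        push_cast; congr 1; ring
      have h2 : ∑ j ∈ Finset.range M, Real.cos ((M - j) * x) =
          Real.cos (M * x) * ∑ j ∈ Finset.range M, Real.cos (j * x) +
          Real.sin (M * x) * ∑ j ∈ Finset.range M, Real.sin (j * x) := by
        rw [Finset.mul_sum, Finset.mul_sum, ← Finset.sum_add_distrib]
        refine Finset.sum_congr rfl fun j _ => ?_
        rw [sub_mul, Real.cos_sub]
      have h3 : ∑ m ∈ Finset.range (M + 1), (((M + 1 : ℕ) : ℝ) - (m + 1)) * Real.cos ((m + 1) * x)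
          = ∑ m ∈ Finset.range M, ((M : ℝ) - (m + 1)) * Real.cos ((m + 1) * x) +
            ∑ m ∈ Finset.range M, Real.cos ((m + 1) * x) := by
        rw [Finset.sum_range_succ, ← Finset.sum_add_distrib]
        push_cast
        rw [sub_self, zero_mul, add_zero]
        refine Finset.sum_congr rfl fun j _ => ?_
        ring
      rw [h3, h1, h2, Finset.sum_range_succ, Finset.sum_range_succ]
      have := Real.sin_sq_add_cos_sq (M * x)
      push_cast
      linear_combination ih - this
  rw [key]; positivity

/-! ### Logarithmic derivatives in Hardy fields. -/

theorem eventually_hasDerivAt_of_contDiffOn {f : ℝ → ℝ} {T : ℝ}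
    (hf : ContDiffOn ℝ ∞ f (Set.Ioi T)) : ∀ᶠ t in atTop, HasDerivAt f (deriv f t) t := by
  filter_upwards [eventually_gt_atTop T] with t ht
  exact ((hf.differentiableOn (by simp) t ht).differentiableAt (Ioi_mem_nhds ht)).hasDerivAt

namespace IsHardyField

variable {F : Subring (Germ (atTop : Filter ℝ) ℝ)} {f : ℝ → ℝ}

theorem eventually_hasDerivAt (hF : IsHardyField F) (hf : (f : Germ (atTop : Filter ℝ) ℝ) ∈ F) :
    ∀ᶠ t in atTop, HasDerivAt f (deriv f t) t := by
  obtain ⟨T, hT⟩ := hF.smooth f hf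
  exact eventually_hasDerivAt_of_contDiffOn hT

theorem exists_inv (hF : IsHardyField F) (hf : (f : Germ (atTop : Filter ℝ) ℝ) ∈ F)
    (h0 : ¬ ∀ᶠ t in atTop, f t = 0) :
    ∃ g : ℝ → ℝ, (g : Germ (atTop : Filter ℝ) ℝ) ∈ F ∧ ∀ᶠ t in atTop, f t * g t = 1 := by
  have hne : (⟨f, hf⟩ : F) ≠ 0 := by
    intro h
    apply h0
    have h1 := congrArg Subtype.val h
    exact Germ.coe_eq.1 (h1 : (f : Germ (atTop : Filter ℝ) ℝ) = ((fun _ => 0 : ℝ → ℝ) : Germ _ ℝ))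
  obtain ⟨⟨b, hb⟩, hab⟩ := hF.isField.mul_inv_cancel hne
  induction b using Germ.inductionOn with
  | _ g =>
    refine ⟨g, hb, ?_⟩
    have h1 := congrArg Subtype.val hab
    exact Germ.coe_eq.1
      (h1 : ((f * g : ℝ → ℝ) : Germ (atTop : Filter ℝ) ℝ) = ((fun _ => 1 : ℝ → ℝ) : Germ _ ℝ))

/-- A non-zero germ is invertible, so a representative has no zeros far out; continuity then fixes
its sign. -/
theorem eventually_sign (hF : IsHardyField F) (hf : (f : Germ (atTop : Filter ℝ) ℝ) ∈ F) :
    (∀ᶠ t in atTop, f t = 0) ∨ (∀ᶠ t in atTop, 0 < f t) ∨ (∀ᶠ t in atTop, f t < 0) := by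
  by_cases h0 : ∀ᶠ t in atTop, f t = 0
  · exact Or.inl h0
  right
  obtain ⟨g, -, hg⟩ := hF.exists_inv hf h0
  obtain ⟨T, hT⟩ := hF.smooth f hf
  obtain ⟨T', hT'⟩ := eventually_atTop.1 hg
  set R := max (T + 1) T'
  have hcont : ContinuousOn f (Set.Ici R) := hT.continuousOn.mono fun t ht => by
    have : T + 1 ≤ t := (le_max_left _ _).trans ht
    exact Set.mem_Ioi.2 (by linarith)
  have hne : ∀ t ∈ Set.Ici R, f t ≠ 0 := fun t ht h => by
    have := hT' t ((le_max_right _ _).trans ht)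
    simp [h] at this
  have hpre : IsPreconnected (f '' Set.Ici R) := isPreconnected_Ici.image f hcont
  have hmem : ∀ t, R ≤ t → f t ∈ f '' Set.Ici R := fun t ht => ⟨t, ht, rfl⟩
  rcases lt_or_gt_of_ne (hne R Set.self_mem_Ici) with h | h
  · right
    filter_upwards [eventually_ge_atTop R] with t ht
    by_contra hcon
    obtain ⟨x, hx, hx0⟩ := hpre.Icc_subset (hmem R le_rfl) (hmem t ht) ⟨h.le, not_lt.1 hcon⟩
    exact hne x hx hx0
  · left
    filter_upwards [eventually_ge_atTop R] with t ht
    by_contra hcon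
    obtain ⟨x, hx, hx0⟩ := hpre.Icc_subset (hmem t ht) (hmem R le_rfl) ⟨not_lt.1 hcon, h.le⟩
    exact hne x hx hx0

/-- Only rational constants are guaranteed to lie in `F`; clearing the denominator keeps the
comparison inside the subring. -/
theorem eventually_le_or_lt (hF : IsHardyField F) (hf : (f : Germ (atTop : Filter ℝ) ℝ) ∈ F)
    (d : ℚ) : (∀ᶠ t in atTop, f t ≤ d) ∨ (∀ᶠ t in atTop, (d : ℝ) < f t) := by
  have hmem : ((fun t => d.den * f t - d.num : ℝ → ℝ) : Germ (atTop : Filter ℝ) ℝ) ∈ F := by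
    have h1 : ((d.den : ℕ) : Germ (atTop : Filter ℝ) ℝ) * (f : Germ (atTop : Filter ℝ) ℝ) -
        ((d.num : ℤ) : Germ (atTop : Filter ℝ) ℝ) ∈ F :=
      F.sub_mem (F.mul_mem (natCast_mem F _) hf) (intCast_mem F _)
    exact h1
  have hden : (0 : ℝ) < d.den := by exact_mod_cast d.pos
  have hd : (d : ℝ) = d.num / d.den := by exact_mod_cast (Rat.num_div_den d).symm
  rcases hF.eventually_sign hmem with h | h | h
  · left
    filter_upwards [h] with t ht
    rw [hd, le_div_iff₀ hden]; linarith
  · right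
    filter_upwards [h] with t ht
    rw [hd, div_lt_iff₀ hden]; linarith
  · left
    filter_upwards [h] with t ht
    rw [hd, le_div_iff₀ hden]; linarith

end IsHardyField

theorem eventually_le_mul_of_deriv_le {q q' : ℝ → ℝ} {d d' : ℝ} (hdd : d < d')
    (hq : ∀ᶠ t in atTop, HasDerivAt q (q' t) t) (hle : ∀ᶠ t in atTop, q' t ≤ d) :
    ∀ᶠ t in atTop, q t ≤ d' * t := by
  obtain ⟨T, hT⟩ := eventually_atTop.1 (hq.and hle)
  filter_upwards [eventually_ge_atTop T, eventually_ge_atTop ((q T - d * T) / (d' - d))]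
    with t ht ht2
  rw [div_le_iff₀ (by linarith)] at ht2
  have := (convex_Ici T).image_sub_le_mul_sub_of_deriv_le (f := q) (C := d)
    (fun x hx => (hT x hx).1.continuousAt.continuousWithinAt)
    (fun x hx => by
      rw [interior_Ici] at hx
      exact (hT x (le_of_lt hx)).1.differentiableAt.differentiableWithinAt)
    (fun x hx => by
      rw [interior_Ici] at hx
      rw [(hT x (le_of_lt hx)).1.deriv]
      exact (hT x (le_of_lt hx)).2) T Set.self_mem_Ici t ht ht
  linarith

theorem eventually_mul_le_of_le_deriv {q q' : ℝ → ℝ} {d d' : ℝ} (hdd : d' < d)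
    (hq : ∀ᶠ t in atTop, HasDerivAt q (q' t) t) (hle : ∀ᶠ t in atTop, d ≤ q' t) :
    ∀ᶠ t in atTop, d' * t ≤ q t := by
  have := eventually_le_mul_of_deriv_le (q := fun t => -q t) (q' := fun t => -q' t)
    (neg_lt_neg hdd) (hq.mono fun t ht => ht.neg) (hle.mono fun t ht => neg_le_neg ht)
  filter_upwards [this] with t ht
  linarith

/-- The hypothesis says exactly that f(t)·t^(-β) has non-negative derivative. -/
theorem exists_rpow_le_of_mul_le_mul_deriv {f f' : ℝ → ℝ} {β : ℝ}
    (hf : ∀ᶠ t in atTop, HasDerivAt f (f' t) t) (hpos : ∀ᶠ t in atTop, 0 < f t)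
    (hle : ∀ᶠ t in atTop, β * f t ≤ t * f' t) :
    ∃ c : ℝ, 0 < c ∧ ∀ᶠ t in atTop, c * t ^ β ≤ f t := by
  obtain ⟨T, hT⟩ := eventually_atTop.1
    ((hf.and (hpos.and hle)).and (eventually_gt_atTop (0 : ℝ)))
  have hder : ∀ t, T ≤ t → HasDerivAt (fun s => f s * s ^ (-β))
      (f' t * t ^ (-β) + f t * (-β * t ^ (-β - 1))) t := fun t ht =>
    (hT t ht).1.1.mul (Real.hasDerivAt_rpow_const (Or.inl (hT t ht).2.ne'))
  have hmono : MonotoneOn (fun s => f s * s ^ (-β)) (Set.Ici T) := by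
    refine monotoneOn_of_deriv_nonneg (convex_Ici T)
      (fun x hx => (hder x hx).continuousAt.continuousWithinAt) ?_ ?_
    · intro x hx
      rw [interior_Ici] at hx
      exact (hder x (le_of_lt hx)).differentiableAt.differentiableWithinAt
    · intro x hx
      rw [interior_Ici] at hx
      have hx' : T ≤ x := le_of_lt hx
      rw [(hder x hx').deriv]
      have hx0 := (hT x hx').2
      rw [Real.rpow_sub hx0, Real.rpow_one]
      have h1 := (hT x hx').1.2.2
      have h2 : 0 < x ^ (-β) := Real.rpow_pos_of_pos hx0 _
      have : f' x * x ^ (-β) + f x * (-β * (x ^ (-β) / x)) =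
        (x * f' x - β * f x) * (x ^ (-β) / x) := by field_simp; ring
      rw [this]
      exact mul_nonneg (by linarith) (by positivity)
  have hT0 := (hT T le_rfl).2
  refine ⟨f T * T ^ (-β), mul_pos (hT T le_rfl).1.2.1 (Real.rpow_pos_of_pos hT0 _), ?_⟩
  filter_upwards [eventually_ge_atTop T] with t ht
  have h1 := hmono Set.self_mem_Ici ht ht
  have ht0 := (hT t ht).2
  have h2 : 0 < t ^ β := Real.rpow_pos_of_pos ht0 _
  calc f T * T ^ (-β) * t ^ β ≤ f t * t ^ (-β) * t ^ β := by
        exact mul_le_mul_of_nonneg_right h1 h2.le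
    _ = f t := by rw [Real.rpow_neg ht0.le]; field_simp

theorem exists_le_rpow_of_mul_deriv_le {f f' : ℝ → ℝ} {β : ℝ}
    (hf : ∀ᶠ t in atTop, HasDerivAt f (f' t) t) (hpos : ∀ᶠ t in atTop, 0 < f t)
    (hle : ∀ᶠ t in atTop, t * f' t ≤ β * f t) :
    ∃ c : ℝ, 0 < c ∧ ∀ᶠ t in atTop, f t ≤ c * t ^ β := by
  obtain ⟨c, hc, h⟩ := exists_rpow_le_of_mul_le_mul_deriv (f := fun t => (f t)⁻¹)
    (f' := fun t => -f' t / f t ^ 2) (β := -β)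
    (by filter_upwards [hf, hpos] with t h1 h2 using h1.inv h2.ne')
    (by filter_upwards [hpos] with t h1 using inv_pos.2 h1)
    (by
      filter_upwards [hle, hpos] with t h1 h2
      have e1 : -β * (f t)⁻¹ = (-(β * f t)) / f t ^ 2 := by field_simp
      have e2 : t * (-f' t / f t ^ 2) = (-(t * f' t)) / f t ^ 2 := by ring
      rw [e1, e2]
      gcongr)
  refine ⟨c⁻¹, inv_pos.2 hc, ?_⟩
  filter_upwards [h, hpos, eventually_gt_atTop 0] with t h1 h2 h3
  have h4 : 0 < t ^ β := Real.rpow_pos_of_pos h3 _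
  rw [Real.rpow_neg h3.le, ← div_eq_mul_inv, ← one_div, div_le_div_iff₀ h4 h2] at h1
  rw [inv_mul_eq_div, le_div_iff₀ hc]
  linarith

theorem eventually_mul_rpow_lt {α β : ℝ} (hαβ : α < β) (C : ℝ) {c : ℝ} (hc : 0 < c) :
    ∀ᶠ t : ℝ in atTop, C * t ^ α < c * t ^ β := by
  have h := (tendsto_rpow_atTop (sub_pos.2 hαβ)).eventually_gt_atTop (C / c)
  filter_upwards [h, eventually_gt_atTop 0] with t ht ht0
  rw [div_lt_iff₀ hc, Real.rpow_sub ht0, div_mul_eq_mul_div,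
    lt_div_iff₀ (Real.rpow_pos_of_pos ht0 _)] at ht
  linarith

/-- Logarithmic derivatives in a Hardy field: a positive exponent of growth `a` of `f` is the limit
of `t f'(t) / f(t)`. -/
theorem IsHardyField.eventually_mul_deriv_bounds {F : Subring (Germ (atTop : Filter ℝ) ℝ)}
    (hF : IsHardyField F) {f : ℝ → ℝ} (hf : (f : Germ (atTop : Filter ℝ) ℝ) ∈ F) {a : ℝ}
    (ha : 0 < a) (hub : ∀ ε > 0, ∀ᶠ t : ℝ in atTop, f t ≤ t ^ (a + ε))
    (hlb : ∀ ε > 0, ∃ᶠ t : ℝ in atTop, t ^ (a - ε) < f t) :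
    (∀ᶠ t in atTop, 0 < f t) ∧
      ∀ ε > 0, ∀ᶠ t in atTop, (a - ε) * f t ≤ t * deriv f t ∧ t * deriv f t ≤ (a + ε) * f t := by
  have hpos : ∀ᶠ t in atTop, 0 < f t := by
    have hfr : ∃ᶠ t in atTop, 0 < f t := by
      refine ((hlb a ha).and_eventually (eventually_gt_atTop 0)).mono fun t ht => ?_
      exact (Real.rpow_pos_of_pos ht.2 _).trans ht.1
    rcases hF.eventually_sign hf with h | h | h
    · exact absurd (h.mono fun t ht => not_lt.2 ht.le) hfr
    · exact h
    · exact absurd (h.mono fun t ht => not_lt.2 ht.le) hfr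
  have hder := hF.eventually_hasDerivAt hf
  have hf' := hF.deriv_mem f hf
  have hpos' : ∀ᶠ t in atTop, 0 < deriv f t := by
    have key : ¬ ∀ᶠ t in atTop, deriv f t ≤ 0 := by
      intro h
      obtain ⟨c, hc, hle⟩ := exists_le_rpow_of_mul_deriv_le (β := 0) hder hpos (by
        filter_upwards [h, eventually_gt_atTop 0] with t h1 h2
        nlinarith)
      refine hlb (a / 2) (by positivity) ?_
      filter_upwards [hle, eventually_mul_rpow_lt (show (0 : ℝ) < a - a / 2 by linarith) c one_pos]
        with t h1 h2
      linarith
    rcases hF.eventually_sign hf' with h | h | h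
    · exact absurd (h.mono fun t ht => ht.le) key
    · exact h
    · exact absurd (h.mono fun t ht => ht.le) key
  -- The quotient q = f/f' is used instead of t f'/f because the germ of t need not belong to `F`.
  -- The derivative q' can be compared with every rational, and integrating the comparison bounds q
  -- by a multiple of t; on the wrong side this contradicts the growth of f.
  obtain ⟨g, hg, hfg⟩ := hF.exists_inv hf' fun h =>
    (hpos'.and h).exists.elim fun t ht => ht.1.ne' ht.2
  set q : ℝ → ℝ := f * g with hq
  have hqF : (q : Germ (atTop : Filter ℝ) ℝ) ∈ F := F.mul_mem hf hg
  have hq1 : ∀ᶠ t in atTop, q t * deriv f t = f t := by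
    filter_upwards [hfg] with t ht
    simp only [hq, Pi.mul_apply]
    linear_combination f t * ht
  have hqder := hF.eventually_hasDerivAt hqF
  have hq' := hF.deriv_mem q hqF
  refine ⟨hpos, fun ε hε => Filter.Eventually.and ?_ ?_⟩
  · -- `t f' ≥ (a - ε) f`
    by_cases haε : a - ε ≤ 0
    · filter_upwards [hpos, hpos', eventually_gt_atTop 0] with t h1 h2 h3
      have := mul_pos h3 h2
      nlinarith
    push Not at haε
    have hlt : a⁻¹ < (a - ε)⁻¹ := by
      rw [inv_lt_inv₀ ha haε]; linarith
    -- Here 1/a < d' < d < 1/(a - ε). If q' ≤ d, then q ≤ t/(a - ε), which is the claim. If q' > d,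
    -- then q ≥ d't, so f is O(t^(1/d')) with 1/d' < a, against the lower growth bound.
    obtain ⟨d, hd1, hd2⟩ := exists_rat_btwn hlt
    obtain ⟨d', hd'1, hd'2⟩ := exists_between hd1
    rcases hF.eventually_le_or_lt hq' d with h | h
    · filter_upwards [eventually_le_mul_of_deriv_le hd2 hqder h, hq1, hpos', hpos] with t h1 h2 h3 h4
      rw [inv_mul_eq_div, le_div_iff₀ haε] at h1
      rw [← h2]
      nlinarith
    · exfalso
      have h5 := eventually_mul_le_of_le_deriv hd'2 hqder (h.mono fun t ht => ht.le)
      have hd'0 : 0 < d' := (inv_pos.2 ha).trans hd'1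
      obtain ⟨c, hc, hle⟩ := exists_le_rpow_of_mul_deriv_le (β := d'⁻¹) hder hpos (by
        filter_upwards [h5, hq1, hpos'] with t h1 h2 h3
        rw [← h2, inv_mul_eq_div, le_div_iff₀ hd'0]
        nlinarith)
      have hd'a : d'⁻¹ < a := by
        rw [inv_lt_comm₀ hd'0 ha]; exact hd'1
      refine hlb ((a - d'⁻¹) / 2) (by linarith) ?_
      filter_upwards [hle, eventually_mul_rpow_lt
        (show d'⁻¹ < a - (a - d'⁻¹) / 2 by linarith) c one_pos] with t h1 h2
      linarith
  · have hlt : (a + ε)⁻¹ < a⁻¹ := by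
      rw [inv_lt_inv₀ (by positivity) ha]; linarith
    obtain ⟨d', hd'1, hd'2⟩ := exists_between hlt
    have hd'0 : 0 < d' := lt_trans (by positivity) hd'1
    obtain ⟨d, hd1, hd2⟩ := exists_rat_btwn hd'1
    rcases hF.eventually_le_or_lt hq' d with h | h
    · exfalso
      have h5 := eventually_le_mul_of_deriv_le hd2 hqder h
      obtain ⟨c, hc, hle⟩ := exists_rpow_le_of_mul_le_mul_deriv (β := d'⁻¹) hder hpos (by
        filter_upwards [h5, hq1, hpos'] with t h1 h2 h3
        rw [← h2, inv_mul_eq_div, div_le_iff₀ hd'0]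
        nlinarith)
      have hd'a : a < d'⁻¹ := by
        rw [lt_inv_comm₀ ha hd'0]; exact hd'2
      have := (hle.and ((hub ((d'⁻¹ - a) / 2) (by linarith)).and (eventually_mul_rpow_lt
        (show a + (d'⁻¹ - a) / 2 < d'⁻¹ by linarith) 1 hc))).exists
      obtain ⟨t, h1, h2, h3⟩ := this
      linarith
    · filter_upwards [eventually_mul_le_of_le_deriv hd1 hqder (h.mono fun t ht => ht.le),
        hq1, hpos', hpos] with t h1 h2 h3 h4
      rw [inv_mul_eq_div, div_le_iff₀ (by positivity)] at h1
      rw [← h2]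
      nlinarith

/-! ### Reduction of Hardy field functions to convex growth. -/

/-- Convex growth between `t ^ (1 + κ)` and `t ^ 2`, expressed through two derivatives. -/
structure HasConvexGrowth (f f₁ f₂ : ℝ → ℝ) (κ t₀ : ℝ) : Prop where
  one_le_start : 1 ≤ t₀
  pos : 0 < κ
  hasDerivAt : ∀ t, t₀ ≤ t → HasDerivAt f (f₁ t) t
  hasDerivAt_deriv : ∀ t, t₀ ≤ t → HasDerivAt f₁ (f₂ t) t
  one_le : ∀ t, t₀ ≤ t → 1 ≤ f t
  one_le_deriv : ∀ t, t₀ ≤ t → 1 ≤ f₁ t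
  lower : ∀ t, t₀ ≤ t → κ * f₁ t ≤ t * f₂ t
  upper : ∀ t, t₀ ≤ t → t * f₂ t ≤ f₁ t

theorem eventually_withBot_lt (u : WithBot ℝ) : ∀ᶠ t : ℝ in atTop, u < (t : WithBot ℝ) := by
  induction u with
  | bot => exact Eventually.of_forall fun t => WithBot.bot_lt_coe t
  | coe u => exact (eventually_gt_atTop u).mono fun t ht => WithBot.coe_lt_coe.2 ht

/-- The logarithmic derivative bounds are applied twice: to f, which shows that f' has growth
exponent c - 1, and then to f'. The condition c > 1 gives a positive κ, and c < 2 gives t f'' ≤ f'.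
-/
theorem IsHardyField.exists_hasConvexGrowth {F : Subring (Germ (atTop : Filter ℝ) ℝ)}
    (hF : IsHardyField F) {f : ℝ → ℝ} (hf : (f : Germ (atTop : Filter ℝ) ℝ) ∈ F) {c : ℝ}
    (hc1 : 1 < c) (hc2 : c < 2) (hub : ∀ ε > 0, ∀ᶠ t : ℝ in atTop, f t ≤ t ^ (c + ε))
    (hlb : ∀ ε > 0, ∃ᶠ t : ℝ in atTop, t ^ (c - ε) < f t) (u : WithBot ℝ) :
    (∀ ε > 0, ∀ᶠ t : ℝ in atTop, deriv f t ≤ t ^ (c - 1 + ε)) ∧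
    ∃ κ t₀ : ℝ, HasConvexGrowth f (deriv f) (deriv (deriv f)) κ t₀ ∧
      ∀ t, t₀ ≤ t → u < (t : WithBot ℝ) := by
  have hc0 : 0 < c := by linarith
  have hc10 : 0 < c - 1 := by linarith
  have hder := hF.eventually_hasDerivAt hf
  have hf1 := hF.deriv_mem f hf
  have hder1 := hF.eventually_hasDerivAt hf1
  obtain ⟨hpos, hlog⟩ := hF.eventually_mul_deriv_bounds hf hc0 hub hlb
  have hub1 : ∀ ε > 0, ∀ᶠ t : ℝ in atTop, deriv f t ≤ t ^ (c - 1 + ε) := by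
    intro ε hε
    filter_upwards [hlog 1 one_pos, hub (ε / 2) (by positivity), eventually_gt_atTop 0,
      eventually_mul_rpow_lt (show c + ε / 2 < c + ε by linarith) (c + 1) one_pos]
      with t h1 h2 h3 h4
    have : t * deriv f t ≤ t * t ^ (c - 1 + ε) := by
      rw [mul_comm t (t ^ _), ← Real.rpow_add_one h3.ne', show c - 1 + ε + 1 = c + ε by ring]
      nlinarith [h1.2]
    exact le_of_mul_le_mul_left this h3
  have hlb1 : ∀ ε > 0, ∀ᶠ t : ℝ in atTop, t ^ (c - 1 - ε) < deriv f t := by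
    intro ε hε
    -- The bound ε/2 leaves room in the exponent; the bound c/2 keeps c - δ ≥ c/2 in the lower
    -- estimate for t f'.
    set δ := min (ε / 2) (c / 2)
    have hδ : 0 < δ := by positivity
    obtain ⟨b, hb, hle⟩ := exists_rpow_le_of_mul_le_mul_deriv hder hpos
      ((hlog δ hδ).mono fun t ht => ht.1)
    filter_upwards [hlog δ hδ, hle, eventually_gt_atTop 0, hpos,
      eventually_mul_rpow_lt (show c - ε < c - δ by
        linarith [min_le_left (ε / 2) (c / 2)]) (2 / c) hb]
      with t h1 h2 h3 h4 h5
    have : t * t ^ (c - 1 - ε) < t * deriv f t := by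
      rw [mul_comm t (t ^ _), ← Real.rpow_add_one h3.ne', show c - 1 - ε + 1 = c - ε by ring]
      have h6 : c / 2 ≤ c - δ := by linarith [min_le_right (ε / 2) (c / 2)]
      have h7 : c / 2 * f t ≤ t * deriv f t := (mul_le_mul_of_nonneg_right h6 h4.le).trans h1.1
      have h8 : 2 / c * t ^ (c - ε) < f t := h5.trans_le h2
      rw [div_mul_eq_mul_div, div_lt_iff₀ hc0] at h8
      linarith
    exact lt_of_mul_lt_mul_left this h3.le
  refine ⟨hub1, (c - 1) / 2, ?_⟩
  obtain ⟨hpos1, hlog1⟩ := hF.eventually_mul_deriv_bounds hf1 hc10 hub1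
    (fun ε hε => (hlb1 ε hε).frequently)
  have hone1 : ∀ᶠ t in atTop, 1 ≤ deriv f t := by
    filter_upwards [hlb1 (c - 1) hc10] with t ht
    simpa using ht.le
  have hone : ∀ᶠ t in atTop, 1 ≤ f t := by
    filter_upwards [hlog 1 one_pos, hone1, eventually_ge_atTop (c + 1), hpos] with t h1 h2 h3 h4
    have := h1.2
    have h5 : (c + 1) * 1 ≤ t * deriv f t :=
      mul_le_mul h3 h2 zero_le_one (by linarith)
    nlinarith
  have hlow : ∀ᶠ t in atTop, (c - 1) / 2 * deriv f t ≤ t * deriv (deriv f) t := by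
    filter_upwards [hlog1 ((c - 1) / 2) (by positivity)] with t ht
    linarith [ht.1]
  have hupp : ∀ᶠ t in atTop, t * deriv (deriv f) t ≤ deriv f t := by
    filter_upwards [hlog1 (2 - c) (by linarith)] with t ht
    linarith [ht.2]
  obtain ⟨t₀, ht₀⟩ := eventually_atTop.1 ((hder.and hder1).and ((hone.and hone1).and
    ((hlow.and hupp).and ((eventually_withBot_lt u).and (eventually_ge_atTop 1)))))
  exact ⟨t₀, ⟨(ht₀ t₀ le_rfl).2.2.2.2, by positivity, fun t ht => (ht₀ t ht).1.1,
    fun t ht => (ht₀ t ht).1.2, fun t ht => (ht₀ t ht).2.1.1, fun t ht => (ht₀ t ht).2.1.2,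
    fun t ht => (ht₀ t ht).2.2.1.1, fun t ht => (ht₀ t ht).2.2.1.2⟩,
    fun t ht => (ht₀ t ht).2.2.2.1⟩

/-- A Hardy field function of growth rate `c ∈ (1, 2)` is, up to sign, of convex growth. -/
theorem IsHardyFieldFunction.exists_hasConvexGrowth {u : WithBot ℝ} {h : ℝ → ℝ} {c : ℝ}
    (hh : IsHardyFieldFunction u h) (hgrowth : HasGrowthRate h c) (hc1 : 1 < c) (hc2 : c < 2) :
    ∃ f : ℝ → ℝ, (f = h ∨ f = fun t => -h t) ∧
      (∀ ε > 0, ∀ᶠ t : ℝ in atTop, f t ≤ t ^ (c + ε)) ∧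
      (∀ ε > 0, ∀ᶠ t : ℝ in atTop, deriv f t ≤ t ^ (c - 1 + ε)) ∧
      ∃ κ t₀ : ℝ, HasConvexGrowth f (deriv f) (deriv (deriv f)) κ t₀ ∧
        ∀ t, t₀ ≤ t → u < (t : WithBot ℝ) := by
  obtain ⟨-, F, hF, hhF⟩ := hh
  have hub : ∀ ε > 0, ∀ᶠ t : ℝ in atTop, |h t| ≤ t ^ (c + ε) := by
    intro ε hε
    obtain ⟨α, hα, hlt⟩ := (isGLB_lt_iff hgrowth).1 (show c < c + ε by linarith)
    filter_upwards [hα, eventually_ge_atTop 1] with t h1 h2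
    exact h1.trans (Real.rpow_le_rpow_of_exponent_le h2 hlt.le)
  have hlb : ∀ ε > 0, ∃ᶠ t : ℝ in atTop, t ^ (c - ε) < |h t| := by
    intro ε hε hcon
    have : c ≤ c - ε := hgrowth.1 (hcon.mono fun t ht => not_lt.1 ht)
    linarith
  have main : ∀ f : ℝ → ℝ, (f : Germ (atTop : Filter ℝ) ℝ) ∈ F → (∀ᶠ t in atTop, |h t| = f t) →
      (∀ ε > 0, ∀ᶠ t : ℝ in atTop, f t ≤ t ^ (c + ε)) ∧
      (∀ ε > 0, ∀ᶠ t : ℝ in atTop, deriv f t ≤ t ^ (c - 1 + ε)) ∧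
      ∃ κ t₀ : ℝ, HasConvexGrowth f (deriv f) (deriv (deriv f)) κ t₀ ∧
        ∀ t, t₀ ≤ t → u < (t : WithBot ℝ) := by
    intro f hfF hfh
    have hub' : ∀ ε > 0, ∀ᶠ t : ℝ in atTop, f t ≤ t ^ (c + ε) := fun ε hε => by
      filter_upwards [hub ε hε, hfh] with t h1 h2 using h2 ▸ h1
    exact ⟨hub', hF.exists_hasConvexGrowth hfF hc1 hc2 hub'
      (fun ε hε => ((hlb ε hε).and_eventually hfh).mono fun t ht => ht.2 ▸ ht.1) u⟩
  rcases hF.eventually_sign hhF with h0 | h0 | h0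
  · exfalso
    refine hlb 1 one_pos ?_
    filter_upwards [h0, eventually_gt_atTop 0] with t h1 h2
    have := Real.rpow_pos_of_pos h2 (c - 1)
    simp [h1, this.le]
  · exact ⟨h, Or.inl rfl, main h hhF (h0.mono fun t ht => abs_of_pos ht)⟩
  · refine ⟨fun t => -h t, Or.inr rfl, main _ ?_ (h0.mono fun t ht => abs_of_neg ht)⟩
    exact F.neg_mem hhF

/-! ### Fourier expansion of the smoothed floor exponential. -/

/-- The additive character `x ↦ exp (2 π i x)`. -/
noncomputable def unitExp (x : ℝ) : ℂ := Complex.exp ((2 * Real.pi * x : ℝ) * Complex.I)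

theorem unitExp_add (x y : ℝ) : unitExp (x + y) = unitExp x * unitExp y := by
  rw [unitExp, unitExp, unitExp, ← Complex.exp_add]; congr 1; push_cast; ring

@[simp] theorem unitExp_zero : unitExp 0 = 1 := by simp [unitExp]

@[simp] theorem norm_unitExp (x : ℝ) : ‖unitExp x‖ = 1 := Complex.norm_exp_ofReal_mul_I _

theorem unitExp_re (x : ℝ) : (unitExp x).re = Real.cos (2 * Real.pi * x) :=
  Complex.exp_ofReal_mul_I_re _

@[simp] theorem unitExp_intCast (n : ℤ) : unitExp n = 1 := by
  rw [unitExp, Complex.exp_eq_one_iff]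
  exact ⟨n, by push_cast; ring⟩

theorem unitExp_nat_mul (n : ℕ) (x : ℝ) : unitExp (n * x) = unitExp x ^ n := by
  rw [unitExp, unitExp, ← Complex.exp_nat_mul]; congr 1; push_cast; ring

theorem unitExp_int_mul_fract (k : ℤ) (x : ℝ) : unitExp (k * Int.fract x) = unitExp (k * x) := by
  have h : (k : ℝ) * x = k * Int.fract x + ((k * ⌊x⌋ : ℤ) : ℝ) := by
    push_cast; rw [← mul_add, Int.fract_add_floor]
  rw [h, unitExp_add, unitExp_intCast, mul_one]

@[fun_prop] theorem continuous_unitExp : Continuous unitExp := by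
  unfold unitExp; fun_prop

theorem norm_unitExp_sub_one (x : ℝ) : ‖unitExp x - 1‖ = 2 * |Real.sin (Real.pi * x)| := by
  have h := Complex.norm_exp_I_mul_ofReal_sub_one (2 * Real.pi * x)
  rw [unitExp, mul_comm, h, norm_mul, Real.norm_eq_abs, Real.norm_eq_abs, abs_two]
  congr 3; ring

theorem norm_unitExp_sub_le (x y : ℝ) : ‖unitExp x - unitExp y‖ ≤ 2 * Real.pi * |x - y| := by
  have h : unitExp x - unitExp y = unitExp y * (unitExp (x - y) - 1) := by
    rw [mul_sub, ← unitExp_add, mul_one]; congr 2; ring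
  rw [h, norm_mul, norm_unitExp, one_mul, norm_unitExp_sub_one, mul_assoc]
  have := Real.abs_sin_le_abs (x := Real.pi * (x - y))
  rw [abs_mul, abs_of_pos Real.pi_pos] at this
  linarith

theorem four_mul_abs_le_norm_unitExp_sub_one {x : ℝ} (hx : |x| ≤ 1 / 2) :
    4 * |x| ≤ ‖unitExp x - 1‖ := by
  rw [norm_unitExp_sub_one]
  have hpi := Real.pi_pos
  have h : |Real.pi * x| ≤ Real.pi / 2 := by
    rw [abs_mul, abs_of_pos hpi]; nlinarith
  have := Real.mul_abs_le_abs_sin h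
  rw [abs_mul, abs_of_pos hpi, ← mul_assoc, div_mul_cancel₀ _ hpi.ne'] at this
  linarith

theorem integral_unitExp_mul {α : ℝ} (hα : α ≠ 0) :
    ∫ y in (0 : ℝ)..1, unitExp (α * y) = (unitExp α - 1) / (2 * Real.pi * α * Complex.I) := by
  have hne : (2 * Real.pi * α * Complex.I : ℂ) ≠ 0 := by
    have : (Real.pi : ℂ) ≠ 0 := by exact_mod_cast Real.pi_ne_zero
    have h2 : (α : ℂ) ≠ 0 := by exact_mod_cast hα
    simp [this, h2, Complex.I_ne_zero]
  have := integral_exp_mul_complex (a := 0) (b := 1) hne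
  rw [Complex.ofReal_one, mul_one, Complex.ofReal_zero, mul_zero, Complex.exp_zero] at this
  have e : unitExp α = Complex.exp (2 * Real.pi * α * Complex.I) := by
    rw [unitExp]; push_cast; rfl
  rw [e, ← this]
  refine intervalIntegral.integral_congr fun y _ => ?_
  simp only [unitExp]
  push_cast
  congr 1; ring

theorem ofReal_sin_pi_mul_sq (y : ℝ) : ((Real.sin (Real.pi * y) ^ 2 : ℝ) : ℂ) =
    1 / 2 - (unitExp y + unitExp (-y)) / 4 := by
  have h : Real.sin (Real.pi * y) ^ 2 = 1 / 2 - Real.cos (2 * Real.pi * y) / 2 := by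
    rw [Real.sin_sq_eq_half_sub]; ring_nf
  have h2 : unitExp y + unitExp (-y) = 2 * (Real.cos (2 * Real.pi * y) : ℂ) := by
    rw [Complex.ofReal_cos, Complex.two_cos, unitExp, unitExp]
    push_cast
    congr 2; ring
  rw [h, h2]; push_cast; ring

/-- The continuous function `sin² (π y) e(ξ ⌊y⌋)`. -/
noncomputable def floorWave (ξ y : ℝ) : ℂ :=
  ((Real.sin (Real.pi * y) ^ 2 : ℝ) : ℂ) * unitExp (ξ * ⌊y⌋)

theorem norm_floorWave_le (ξ y : ℝ) : ‖floorWave ξ y‖ ≤ 1 := by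
  rw [floorWave, norm_mul, norm_unitExp, mul_one, Complex.norm_real, Real.norm_of_nonneg (sq_nonneg _)]
  exact Real.sin_sq_le_one _

/-- The coefficients in the expansion of `floorWave`. -/
noncomputable def floorWaveCoeff (θ : ℝ) : ℂ :=
  ∫ y in (0 : ℝ)..1, unitExp (-θ * y) * ((Real.sin (Real.pi * y) ^ 2 : ℝ) : ℂ)

theorem norm_floorWaveCoeff_le_one (θ : ℝ) : ‖floorWaveCoeff θ‖ ≤ 1 := by
  have := intervalIntegral.norm_integral_le_of_norm_le_const (a := 0) (b := 1) (C := 1)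
    (f := fun y : ℝ => unitExp (-θ * y) * ((Real.sin (Real.pi * y) ^ 2 : ℝ) : ℂ)) (fun y _ => by
      rw [norm_mul, norm_unitExp, one_mul, Complex.norm_real, Real.norm_of_nonneg (sq_nonneg _)]
      exact Real.sin_sq_le_one _)
  simpa [floorWaveCoeff] using this

/-- Since sin² is a combination of the frequencies 0 and ±1, three elementary integrals arise, all
with the same numerator by periodicity. The leading parts of 1/θ and 1/(θ ± 1) cancel, which leaves
a cubic denominator. -/
theorem floorWaveCoeff_eq {θ : ℝ} (h0 : θ ≠ 0) (h1 : θ ≠ 1) (h2 : θ ≠ -1) :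
    floorWaveCoeff θ = (unitExp (-θ) - 1) / (4 * Real.pi * θ * (θ ^ 2 - 1) * Complex.I) := by
  have hint : ∀ α : ℝ, IntervalIntegrable (fun y => unitExp (α * y)) MeasureTheory.volume 0 1 :=
    fun α => Continuous.intervalIntegrable (by fun_prop) _ _
  have e1 : floorWaveCoeff θ = (∫ y in (0 : ℝ)..1, unitExp (-θ * y)) / 2 -
      (∫ y in (0 : ℝ)..1, unitExp ((-θ + 1) * y)) / 4 -
      (∫ y in (0 : ℝ)..1, unitExp ((-θ - 1) * y)) / 4 := by
    rw [← intervalIntegral.integral_div, ← intervalIntegral.integral_div,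
      ← intervalIntegral.integral_div, ← intervalIntegral.integral_sub ((hint _).div_const _)
      ((hint _).div_const _), ← intervalIntegral.integral_sub
      (((hint _).div_const _).sub ((hint _).div_const _)) ((hint _).div_const _), floorWaveCoeff]
    refine intervalIntegral.integral_congr fun y _ => ?_
    rw [ofReal_sin_pi_mul_sq, show (-θ + 1) * y = -θ * y + y by ring,
      show (-θ - 1) * y = -θ * y + -y by ring, unitExp_add, unitExp_add]
    ring
  have p1 : unitExp (-θ + 1) = unitExp (-θ) := by
    have := unitExp_intCast 1
    push_cast at this
    rw [unitExp_add, this, mul_one]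
  have p2 : unitExp (-θ - 1) = unitExp (-θ) := by
    rw [sub_eq_add_neg, unitExp_add]
    have := unitExp_intCast (-1)
    push_cast at this
    rw [this, mul_one]
  have n1 : -θ + 1 ≠ 0 := fun h => h1 (by linarith)
  have n2 : -θ - 1 ≠ 0 := fun h => h2 (by linarith)
  rw [e1, integral_unitExp_mul (neg_ne_zero.2 h0), integral_unitExp_mul n1,
    integral_unitExp_mul n2, p1, p2]
  have q0 : (θ : ℂ) ≠ 0 := by exact_mod_cast h0
  have q1 : (-θ + 1 : ℂ) ≠ 0 := by exact_mod_cast n1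
  have q2 : (-θ - 1 : ℂ) ≠ 0 := by exact_mod_cast n2
  have q3 : (θ ^ 2 - 1 : ℂ) ≠ 0 := by
    have : (θ ^ 2 - 1 : ℂ) = (-θ + 1) * (-θ - 1) := by ring
    rw [this]; exact mul_ne_zero q1 q2
  have hpi : (Real.pi : ℂ) ≠ 0 := by exact_mod_cast Real.pi_ne_zero
  have hI := Complex.I_ne_zero
  push_cast
  field_simp
  ring

theorem norm_floorWaveCoeff_mul_le {θ : ℝ} (h : 2 ≤ |θ|) :
    ‖floorWaveCoeff θ‖ * (1 + |θ|) ≤ 1 / |θ| ^ 2 := by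
  have hθ : 0 < |θ| := by linarith
  have h0 : θ ≠ 0 := abs_pos.1 hθ
  have h1 : θ ≠ 1 := by rintro rfl; norm_num at h
  have h2 : θ ≠ -1 := by rintro rfl; norm_num at h
  rw [floorWaveCoeff_eq h0 h1 h2]
  have hs : (θ ^ 2 - 1 : ℂ) = ((|θ| ^ 2 - 1 : ℝ) : ℂ) := by rw [sq_abs]; push_cast; ring
  have hpos : 0 < |θ| ^ 2 - 1 := by nlinarith
  have hnum : ‖unitExp (-θ) - 1‖ ≤ 2 := by
    calc _ ≤ ‖unitExp (-θ)‖ + ‖(1 : ℂ)‖ := norm_sub_le _ _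
      _ = 2 := by simp; norm_num
  have hpi := Real.pi_gt_three
  rw [norm_div, hs]
  simp only [norm_mul, Complex.norm_I, mul_one, Complex.norm_real, Real.norm_eq_abs,
    abs_of_pos Real.pi_pos, abs_of_pos hpos, Complex.norm_ofNat]
  rw [div_mul_eq_mul_div, div_le_div_iff₀ (by positivity) (by positivity), one_mul]
  set x := |θ|
  calc ‖unitExp (-θ) - 1‖ * (1 + x) * x ^ 2 ≤ 2 * (1 + x) * x ^ 2 := by gcongr
    _ ≤ 4 * 3 * x * (x ^ 2 - 1) := by nlinarith [mul_pos hθ hθ]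
    _ ≤ 4 * Real.pi * x * (x ^ 2 - 1) := by gcongr

/-- A summable majorant for the coefficients of `floorWave`, weighted by the frequency. -/
noncomputable def floorWaveBound (k : ℤ) : ℝ := 20 * (1 / (k : ℝ) ^ 2) + if k = 0 then 20 else 0

theorem summable_floorWaveBound : Summable floorWaveBound :=
  ((Real.summable_one_div_int_pow.2 one_lt_two).mul_left 20).add (hasSum_ite_eq 0 (20 : ℝ)).summable

theorem floorWaveBound_nonneg (k : ℤ) : 0 ≤ floorWaveBound k := by
  unfold floorWaveBound; positivity

/-- The factor 1 + |ξ + k| is the loss in frequency of the exponential sum estimate; cubic decay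
leaves a summable 1/k², uniformly in ξ. The few k with |k| ≤ 2, where the closed form may be
singular, are covered by the trivial bound. -/
theorem norm_floorWaveCoeff_mul_le_bound {ξ : ℝ} (h0 : 0 ≤ ξ) (h1 : ξ < 1) (k : ℤ) :
    ‖floorWaveCoeff (ξ + k)‖ * (1 + |ξ + k|) ≤ floorWaveBound k := by
  have hξ : |ξ| ≤ 1 := by rw [abs_of_nonneg h0]; exact h1.le
  rcases eq_or_ne k 0 with rfl | hk
  · have := norm_floorWaveCoeff_le_one (ξ + (0 : ℤ))
    simp only [floorWaveBound, Int.cast_zero, add_zero, if_true] at *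
    have h3 : ‖floorWaveCoeff ξ‖ * (1 + |ξ|) ≤ 1 * (1 + 1) := by gcongr
    norm_num at h3 ⊢; linarith
  simp only [floorWaveBound, if_neg hk, add_zero]
  rw [← sq_abs (k : ℝ)]
  have hk1 : (1 : ℝ) ≤ |(k : ℝ)| := by exact_mod_cast Int.one_le_abs hk
  have hle : |ξ + k| ≤ 1 + |(k : ℝ)| := (abs_add_le _ _).trans (by gcongr)
  have hge : |(k : ℝ)| - 1 ≤ |ξ + k| := by
    have h3 := abs_sub_abs_le_abs_sub (k : ℝ) (-ξ)
    rw [abs_neg, sub_neg_eq_add, add_comm (k : ℝ)] at h3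
    linarith
  rw [mul_one_div, le_div_iff₀ (by positivity)]
  by_cases hk2 : |k| ≤ 2
  · have hk2' : |(k : ℝ)| ≤ 2 := by exact_mod_cast hk2
    have := norm_floorWaveCoeff_le_one (ξ + k)
    calc ‖floorWaveCoeff (ξ + k)‖ * (1 + |ξ + k|) * |(k : ℝ)| ^ 2
        ≤ 1 * (1 + 3) * 2 ^ 2 := by gcongr; linarith
      _ ≤ 20 := by norm_num
  · have hk3 : 3 ≤ |k| := by omega
    have hk3' : (3 : ℝ) ≤ |(k : ℝ)| := by exact_mod_cast hk3
    have h4 := norm_floorWaveCoeff_mul_le (θ := ξ + k) (by linarith)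
    have h5 : 0 < |ξ + (k : ℝ)| := by linarith
    calc _ ≤ 1 / |ξ + k| ^ 2 * |(k : ℝ)| ^ 2 := by gcongr
      _ = (|(k : ℝ)| / |ξ + k|) ^ 2 := by field_simp
      _ ≤ 2 ^ 2 := by
          gcongr
          rw [div_le_iff₀ h5]; linarith
      _ ≤ 20 := by norm_num

theorem summable_norm_floorWaveCoeff {ξ : ℝ} (h0 : 0 ≤ ξ) (h1 : ξ < 1) :
    Summable fun k : ℤ => ‖floorWaveCoeff (ξ + k)‖ := by
  refine Summable.of_nonneg_of_le (fun k => norm_nonneg _) (fun k => ?_) summable_floorWaveBound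
  refine le_trans ?_ (norm_floorWaveCoeff_mul_le_bound h0 h1 k)
  exact le_mul_of_one_le_right (norm_nonneg _) (by linarith [abs_nonneg (ξ + k)])

/-- The expansion of `floorWave` in exponentials of frequencies congruent to `ξ` modulo one. -/
theorem hasSum_floorWave {ξ : ℝ} (h0 : 0 ≤ ξ) (h1 : ξ < 1) (y : ℝ) :
    HasSum (fun k : ℤ => floorWaveCoeff (ξ + k) * unitExp ((ξ + k) * y)) (floorWave ξ y) := by
  -- On [0, 1) this is `floorWave` twisted by e(-ξy). Its periodic extension is continuous because
  -- sin² vanishes at both endpoints, so its absolutely summable Fourier series converges to it at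
  -- every point.
  set G : ℝ → ℂ := fun y => unitExp (-ξ * y) * ((Real.sin (Real.pi * y) ^ 2 : ℝ) : ℂ) with hG
  have hGc : Continuous G := by
    have : Continuous fun y : ℝ => ((Real.sin (Real.pi * y) ^ 2 : ℝ) : ℂ) := by fun_prop
    simp only [hG]; fun_prop
  let g : C(AddCircle (1 : ℝ), ℂ) := ⟨AddCircle.liftIco 1 0 G,
    AddCircle.liftIco_zero_continuous (by simp [hG]) hGc.continuousOn⟩
  have hfour : ∀ (k : ℤ) (x : ℝ), fourier k (x : AddCircle (1 : ℝ)) = unitExp (k * x) := by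
    intro k x
    rw [fourier_coe_apply, unitExp]; congr 1; push_cast; ring
  have hcoef : ∀ k : ℤ, fourierCoeff g k = floorWaveCoeff (ξ + k) := by
    intro k
    rw [fourierCoeff_eq_intervalIntegral _ _ 0, zero_add, one_div, inv_one, one_smul,
      floorWaveCoeff]
    refine intervalIntegral.integral_congr_Ioo_of_le zero_le_one fun x hx => ?_
    simp only [g, ContinuousMap.coe_mk]
    rw [AddCircle.liftIco_zero_coe_apply (Set.Ioo_subset_Ico_self hx), hfour, smul_eq_mul, hG]
    simp only
    rw [← mul_assoc, ← unitExp_add]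
    congr 2; push_cast; ring
  have hsum : Summable (fourierCoeff g) := by
    refine Summable.of_norm ?_
    simpa only [hcoef] using summable_norm_floorWaveCoeff h0 h1
  have hmain := has_pointwise_sum_fourier_series_of_summable hsum
    (Int.fract y : ℝ)
  have hval : g ((Int.fract y : ℝ) : AddCircle (1 : ℝ)) = G (Int.fract y) :=
    AddCircle.liftIco_zero_coe_apply (f := G) ⟨Int.fract_nonneg y, Int.fract_lt_one y⟩
  rw [hval] at hmain
  have hmul := hmain.mul_right (unitExp (ξ * y))
  have hy : Int.fract y = y - ⌊y⌋ := rfl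
  convert! hmul using 1
  · funext k
    rw [hcoef, hfour, unitExp_int_mul_fract, smul_eq_mul, mul_assoc, ← unitExp_add]
    congr 2; ring
  · have hs : Real.sin (Real.pi * Int.fract y) ^ 2 = Real.sin (Real.pi * y) ^ 2 := by
      rw [hy, mul_sub, mul_comm Real.pi (⌊y⌋ : ℝ), Real.sin_sub_int_mul_pi, mul_pow]
      rw [← sq_abs ((-1 : ℝ) ^ ⌊y⌋), abs_zpow, abs_neg, abs_one, one_zpow]
      ring
    simp only [hG, floorWave]
    rw [hs, mul_right_comm, ← unitExp_add, mul_comm, hy]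
    congr 2; ring

theorem continuous_floorWave {ξ : ℝ} (h0 : 0 ≤ ξ) (h1 : ξ < 1) : Continuous (floorWave ξ) := by
  have : floorWave ξ = fun y => ∑' k : ℤ, floorWaveCoeff (ξ + k) * unitExp ((ξ + k) * y) :=
    funext fun y => (hasSum_floorWave h0 h1 y).tsum_eq.symm
  rw [this]
  refine continuous_tsum (fun k => by fun_prop) (summable_norm_floorWaveCoeff h0 h1) fun k y => ?_
  rw [norm_mul, norm_unitExp, mul_one]

/-! ### Geometric sums against integrals, and the rarity of resonances. -/

/-- Translation by j multiplies the integral over one unit by e(jβ). Sum and integral thus differ by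
the factor 1 - c, where c is the integral over [0, 1]. -/
theorem integral_unitExp_eq_sum_mul (β : ℝ) (L : ℕ) :
    ∫ s in (0 : ℝ)..L, unitExp (β * s) =
      (∑ j ∈ Finset.range L, unitExp (j * β)) * ∫ s in (0 : ℝ)..1, unitExp (β * s) := by
  have h := intervalIntegral.sum_integral_adjacent_intervals (μ := MeasureTheory.volume)
    (f := fun s => unitExp (β * s)) (a := fun j : ℕ => (j : ℝ)) (n := L)
    (fun k _ => Continuous.intervalIntegrable (by fun_prop) _ _)
  rw [Nat.cast_zero] at h
  rw [← h, Finset.sum_mul]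
  refine Finset.sum_congr rfl fun j _ => ?_
  have h2 := intervalIntegral.integral_comp_add_right (a := 0) (b := 1)
    (fun s => unitExp (β * s)) (j : ℝ)
  rw [zero_add, add_comm (1 : ℝ)] at h2
  push_cast
  rw [← h2, ← intervalIntegral.integral_const_mul]
  refine intervalIntegral.integral_congr fun s _ => ?_
  rw [← unitExp_add]
  congr 1; ring

/-- A geometric sum is close to the corresponding integral if the frequency is not close to a
non-zero integer. -/
theorem norm_sum_unitExp_sub_integral_le {β ρ : ℝ} (hρ : 0 < ρ) (hρ2 : ρ ≤ 1 / 2) (L : ℕ)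
    (h : ∀ m : ℤ, m ≠ 0 → ρ ≤ |β - m|) :
    ‖∑ j ∈ Finset.range L, unitExp (j * β) - ∫ s in (0 : ℝ)..L, unitExp (β * s)‖ ≤ 2 / ρ := by
  rw [integral_unitExp_eq_sum_mul]
  set A := ∑ j ∈ Finset.range L, unitExp (j * β) with hA
  set c := ∫ s in (0 : ℝ)..1, unitExp (β * s) with hc
  have hround := abs_sub_round β
  have hper : unitExp β = unitExp (β - round β) := by
    have : unitExp ((β - round β) + (round β : ℤ)) = unitExp (β - round β) := by
      rw [unitExp_add, unitExp_intCast, mul_one]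
    rwa [sub_add_cancel] at this
  have hgeom : ‖A‖ * ‖unitExp β - 1‖ ≤ 2 := by
    rw [← norm_mul, hA]
    simp_rw [unitExp_nat_mul]
    rw [geom_sum_mul, ← unitExp_nat_mul]
    calc _ ≤ ‖unitExp (L * β)‖ + ‖(1 : ℂ)‖ := norm_sub_le _ _
      _ = 2 := by simp; norm_num
  have hA4 : ‖A‖ * (4 * |β - round β|) ≤ 2 :=
    (mul_le_mul_of_nonneg_left (hper ▸ four_mul_abs_le_norm_unitExp_sub_one hround)
      (norm_nonneg _)).trans hgeom
  have e : A - A * c = A * (1 - c) := by ring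
  rw [e, norm_mul, le_div_iff₀ hρ]
  -- Near frequency 0 the geometric sum may be as large as 1/(2|β|), but 1 - c is O(|β|) and
  -- compensates; hence no distance from 0 is required. Near any other integer the distance ρ bounds
  -- the geometric sum itself.
  by_cases hm : round β = 0
  · rw [hm, Int.cast_zero, sub_zero] at hA4
    have hc1 : ‖1 - c‖ ≤ 2 * Real.pi * |β| := by
      have h1 : (1 : ℂ) - c = ∫ s in (0 : ℝ)..1, (unitExp 0 - unitExp (β * s)) := by
        rw [intervalIntegral.integral_sub (by simp)
          (Continuous.intervalIntegrable (by fun_prop) _ _)]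
        simp [hc]
      rw [h1]
      have := intervalIntegral.norm_integral_le_of_norm_le_const (a := 0) (b := 1)
        (C := 2 * Real.pi * |β|) (f := fun s : ℝ => unitExp 0 - unitExp (β * s)) (fun s hs => by
          refine (norm_unitExp_sub_le _ _).trans ?_
          rw [Set.uIoc_of_le zero_le_one] at hs
          rw [zero_sub, abs_neg, abs_mul, abs_of_pos hs.1]
          have hpi := Real.pi_pos
          gcongr
          exact mul_le_of_le_one_right (abs_nonneg _) hs.2)
      simpa using this
    have hpi := Real.pi_le_four
    have hpi0 := Real.pi_pos
    have : ‖A‖ * ‖1 - c‖ ≤ 4 := by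
      calc _ ≤ ‖A‖ * (2 * Real.pi * |β|) := by gcongr
        _ = (‖A‖ * (4 * |β|)) * (Real.pi / 2) := by ring
        _ ≤ 2 * (4 / 2) := by gcongr
        _ = 4 := by norm_num
    nlinarith
  · have hc2 : ‖1 - c‖ ≤ 2 := by
      have h2 : ‖c‖ ≤ 1 := by
        have := intervalIntegral.norm_integral_le_of_norm_le_const (a := 0) (b := 1)
          (C := 1) (f := fun s : ℝ => unitExp (β * s)) (fun s _ => by simp)
        simpa using this
      calc _ ≤ ‖(1 : ℂ)‖ + ‖c‖ := norm_sub_le _ _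
        _ ≤ 2 := by rw [norm_one]; linarith
    have h3 := h _ hm
    have h4 : ‖A‖ * (4 * ρ) ≤ 2 := le_trans (by gcongr) hA4
    nlinarith [norm_nonneg A, norm_nonneg (1 - c)]

theorem norm_sum_unitExp_sub_integral_le_two_mul (β : ℝ) (L : ℕ) :
    ‖∑ j ∈ Finset.range L, unitExp (j * β) - ∫ s in (0 : ℝ)..L, unitExp (β * s)‖ ≤ 2 * L := by
  have h1 : ‖∑ j ∈ Finset.range L, unitExp (j * β)‖ ≤ L := by
    refine (norm_sum_le _ _).trans ?_
    simp
  have h2 := intervalIntegral.norm_integral_le_of_norm_le_const (a := 0) (b := (L : ℝ))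
    (C := 1) (f := fun s : ℝ => unitExp (β * s)) (fun s _ => by simp)
  rw [sub_zero, abs_of_nonneg (Nat.cast_nonneg L), one_mul] at h2
  linarith [norm_sub_le (∑ j ∈ Finset.range L, unitExp (j * β))
    (∫ s in (0 : ℝ)..L, unitExp (β * s))]

/-- Well separated points below `B` are rarely close to positive integers. -/
theorem card_near_integer_le {s : Finset ℕ} {x : ℕ → ℝ} {g B ρ : ℝ} (hg : 0 < g)
    (hρ : 0 < ρ) (hρ2 : ρ ≤ 1 / 2)
    (hgap : ∀ i ∈ s, ∀ j ∈ s, i ≤ j → ((j : ℝ) - i) * g ≤ x j - x i)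
    (hB : ∀ i ∈ s, x i ≤ B) (hB0 : 0 ≤ B) (hnear : ∀ i ∈ s, ∃ m : ℕ, 1 ≤ m ∧ |x i - m| < ρ) :
    (s.card : ℝ) ≤ 2 * B * (2 * ρ / g + 1) := by
  choose! m hm1 hm using hnear
  have hmaps : (s : Set ℕ).MapsTo m (Finset.Icc 1 ⌊B + 1 / 2⌋₊) := by
    intro i hi
    have h1 := hm i hi
    have h2 := hB i hi
    rw [abs_lt] at h1
    simp only [Finset.coe_Icc, Set.mem_Icc]
    exact ⟨hm1 i hi, Nat.le_floor (by linarith)⟩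
  rw [Finset.card_eq_sum_card_fiberwise hmaps, Nat.cast_sum]
  have hfib : ∀ k ∈ Finset.Icc 1 ⌊B + 1 / 2⌋₊,
      (({i ∈ s | m i = k} : Finset ℕ).card : ℝ) ≤ 2 * ρ / g + 1 := by
    intro k _
    set t := ({i ∈ s | m i = k} : Finset ℕ) with ht
    rcases t.eq_empty_or_nonempty with h0 | hne
    · rw [h0]; simp; positivity
    have hmin := Finset.mem_filter.1 (t.min'_mem hne)
    have hmax := Finset.mem_filter.1 (t.max'_mem hne)
    have hle : t.min' hne ≤ t.max' hne := t.min'_le_max' hne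
    have hsub : t ⊆ Finset.Icc (t.min' hne) (t.max' hne) := fun i hi =>
      Finset.mem_Icc.2 ⟨t.min'_le i hi, t.le_max' i hi⟩
    have hcard := Finset.card_le_card hsub
    rw [Nat.card_Icc] at hcard
    have hcard' : (t.card : ℝ) ≤ (t.max' hne : ℝ) - t.min' hne + 1 := by
      have : t.card + t.min' hne ≤ t.max' hne + 1 := by omega
      have : (t.card : ℝ) + t.min' hne ≤ t.max' hne + 1 := by exact_mod_cast this
      linarith
    have h1 := hgap _ hmin.1 _ hmax.1 hle
    have h2 := hm _ hmin.1
    have h3 := hm _ hmax.1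
    rw [hmin.2] at h2
    rw [hmax.2] at h3
    rw [abs_lt] at h2 h3
    have h4 : (t.max' hne : ℝ) - t.min' hne ≤ 2 * ρ / g := by
      rw [le_div_iff₀ hg]; linarith
    linarith
  refine (Finset.sum_le_sum hfib).trans ?_
  rw [Finset.sum_const, Nat.card_Icc, nsmul_eq_mul, Nat.add_sub_cancel]
  -- Because 0 is excluded, the number of integers is proportional to B, without an additive
  -- constant. Later B and g are both multiples of |θ|, and an extra constant times ρ/g would blow
  -- up for small θ.
  have hfl : (⌊B + 1 / 2⌋₊ : ℝ) ≤ 2 * B := by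
    rcases lt_or_ge B (1 / 2) with h | h
    · rw [Nat.floor_eq_zero.2 (by linarith)]; simpa using hB0
    · exact (Nat.floor_le (by linarith)).trans (by linarith)
  gcongr

theorem sum_Ico_mul_eq_sum_sum {E : Type*} [AddCommMonoid E] (u : ℕ → E) (L : ℕ) {a b : ℕ}
    (hab : a ≤ b) : ∑ n ∈ Finset.Ico (a * L) (b * L), u n =
      ∑ i ∈ Finset.Ico a b, ∑ j ∈ Finset.range L, u (i * L + j) := by
  induction b, hab using Nat.le_induction with
  | base => simp
  | succ b hb ih =>
    rw [Finset.sum_Ico_succ_top hb, ← ih, ← Finset.sum_Ico_consecutive u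
      (Nat.mul_le_mul_right L hb) (Nat.mul_le_mul_right L b.le_succ),
      Finset.sum_Ico_eq_sum_range u (b * L)]
    congr 2
    rw [Nat.succ_mul, Nat.add_sub_cancel_left]

/-! ### Calculus of functions of convex growth. -/

theorem mul_sub_le_sub_of_hasDerivAt {g g' : ℝ → ℝ} {C t₀ a b : ℝ} (hab : a ≤ b) (ha : t₀ ≤ a)
    (hg : ∀ t, t₀ ≤ t → HasDerivAt g (g' t) t) (hC : ∀ t, a ≤ t → t ≤ b → C ≤ g' t) :
    C * (b - a) ≤ g b - g a := by
  refine (convex_Icc a b).mul_sub_le_image_sub_of_le_deriv (f := g)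
    (fun x hx => (hg x (ha.trans hx.1)).continuousAt.continuousWithinAt)
    (fun x hx => ?_) (fun x hx => ?_) a (Set.left_mem_Icc.2 hab) b (Set.right_mem_Icc.2 hab) hab
      <;> rw [interior_Icc] at hx
  · exact (hg x (ha.trans hx.1.le)).differentiableAt.differentiableWithinAt
  · rw [(hg x (ha.trans hx.1.le)).deriv]
    exact hC x hx.1.le hx.2.le

namespace HasConvexGrowth

variable {f f₁ f₂ : ℝ → ℝ} {κ t₀ : ℝ}

theorem monotoneOn (hf : HasConvexGrowth f f₁ f₂ κ t₀) : MonotoneOn f (Set.Ici t₀) := by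
  refine monotoneOn_of_deriv_nonneg (convex_Ici t₀)
    (fun x hx => (hf.hasDerivAt x hx).continuousAt.continuousWithinAt)
    (fun x hx => ?_) (fun x hx => ?_) <;> rw [interior_Ici] at hx
  · exact (hf.hasDerivAt x (le_of_lt hx)).differentiableAt.differentiableWithinAt
  · rw [(hf.hasDerivAt x (le_of_lt hx)).deriv]
    linarith [hf.one_le_deriv x (le_of_lt hx)]

theorem pos_of_le (hf : HasConvexGrowth f f₁ f₂ κ t₀) {t : ℝ} (ht : t₀ ≤ t) : 0 < t := by linarith [hf.one_le_start]

theorem deriv_pos (hf : HasConvexGrowth f f₁ f₂ κ t₀) {t : ℝ} (ht : t₀ ≤ t) : 0 < f₁ t := by linarith [hf.one_le_deriv t ht]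

theorem deriv_two_nonneg (hf : HasConvexGrowth f f₁ f₂ κ t₀) {t : ℝ} (ht : t₀ ≤ t) : 0 ≤ f₂ t :=
  nonneg_of_mul_nonneg_right ((mul_pos hf.pos (hf.deriv_pos ht)).le.trans (hf.lower t ht))
    (hf.pos_of_le ht)

theorem monotoneOn_deriv (hf : HasConvexGrowth f f₁ f₂ κ t₀) : MonotoneOn f₁ (Set.Ici t₀) := by
  refine monotoneOn_of_deriv_nonneg (convex_Ici t₀)
    (fun x hx => (hf.hasDerivAt_deriv x hx).continuousAt.continuousWithinAt)
    (fun x hx => ?_) (fun x hx => ?_) <;> rw [interior_Ici] at hx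
  · exact (hf.hasDerivAt_deriv x (le_of_lt hx)).differentiableAt.differentiableWithinAt
  · rw [(hf.hasDerivAt_deriv x (le_of_lt hx)).deriv]
    exact hf.deriv_two_nonneg (le_of_lt hx)

theorem antitoneOn_deriv_div (hf : HasConvexGrowth f f₁ f₂ κ t₀) : AntitoneOn (fun t => f₁ t / t) (Set.Ici t₀) := by
  have hder : ∀ x, t₀ ≤ x → HasDerivAt (fun t => f₁ t / t) ((f₂ x * x - f₁ x * 1) / x ^ 2) x :=
    fun x hx => (hf.hasDerivAt_deriv x hx).div (hasDerivAt_id x) (hf.pos_of_le hx).ne'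
  refine antitoneOn_of_deriv_nonpos (convex_Ici t₀)
    (fun x hx => (hder x hx).continuousAt.continuousWithinAt)
    (fun x hx => ?_) (fun x hx => ?_) <;> rw [interior_Ici] at hx
  · exact (hder x (le_of_lt hx)).differentiableAt.differentiableWithinAt
  · rw [(hder x (le_of_lt hx)).deriv]
    refine div_nonpos_of_nonpos_of_nonneg ?_ (sq_nonneg _)
    linarith [hf.upper x (le_of_lt hx)]

/-- Since f'(t)/t decreases, f' is at least f'(X)/2 on [X/2, X]. -/
theorem mul_deriv_le (hf : HasConvexGrowth f f₁ f₂ κ t₀) {X : ℝ} (hX : 2 * t₀ ≤ X) : X * f₁ X / 4 ≤ f X := by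
  have h1 := hf.one_le_start
  have h2 : t₀ ≤ X / 2 := by linarith
  have h3 : t₀ ≤ X := by linarith
  have hX0 := hf.pos_of_le h3
  have h4 := mul_sub_le_sub_of_hasDerivAt (t₀ := t₀) (g := f) (g' := f₁) (C := f₁ X / 2)
    (show X / 2 ≤ X by linarith) h2 hf.hasDerivAt (fun t ht htX => by
      have := hf.antitoneOn_deriv_div (h2.trans ht) h3 htX
      simp only at this
      have ht0 := hf.pos_of_le (h2.trans ht)
      rw [div_le_div_iff₀ hX0 ht0] at this
      have hD := hf.deriv_pos h3
      have : f₁ X * X / 2 ≤ f₁ t * X := by nlinarith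
      rw [mul_div_right_comm] at this
      exact le_of_mul_le_mul_right this hX0)
  linarith [hf.one_le _ h2]

theorem le_add_mul_deriv (hf : HasConvexGrowth f f₁ f₂ κ t₀) {A : ℝ} (hA : t₀ ≤ A) : f A ≤ f t₀ + A * f₁ A := by
  have h1 := mul_sub_le_sub_of_hasDerivAt (t₀ := t₀) (g := fun t => -f t) (g' := fun t => -f₁ t)
    (C := -f₁ A) hA le_rfl (fun t ht => (hf.hasDerivAt t ht).neg)
    (fun t ht htA => neg_le_neg (hf.monotoneOn_deriv ht hA htA))
  nlinarith [hf.deriv_pos hA, hf.one_le_start]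

/-- From f'' ≥ κ f'(t)/t and the monotonicity of f'(t)/t. This separates the frequencies of
different blocks. -/
theorem gap_le (hf : HasConvexGrowth f f₁ f₂ κ t₀) {b L X : ℝ} (hb : t₀ ≤ b) (hL : 0 ≤ L) (hX : b + L ≤ X) :
    L * (κ * (f₁ X / X)) ≤ f₁ (b + L) - f₁ b := by
  have h := mul_sub_le_sub_of_hasDerivAt (t₀ := t₀) (g := f₁) (g' := f₂) (C := κ * (f₁ X / X))
    (show b ≤ b + L by linarith) hb hf.hasDerivAt_deriv (fun t ht htL => by
      have ht' := hb.trans ht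
      have h1 := hf.antitoneOn_deriv_div ht' (show t₀ ≤ X by linarith) (show t ≤ X by linarith)
      simp only at h1
      have h2 := hf.lower t ht'
      have ht0 := hf.pos_of_le ht'
      have h3 : κ * (f₁ t / t) ≤ f₂ t := by
        rw [← mul_div_assoc, div_le_iff₀ ht0]; linarith
      exact (mul_le_mul_of_nonneg_left h1 hf.pos.le).trans h3)
  linarith

end HasConvexGrowth

/-! ### The weight, and linearisation on a block. -/

/-- The weight `(1 - f(t) / f(X)) f'(t)`. -/
noncomputable def growthWeight (f f₁ : ℝ → ℝ) (X t : ℝ) : ℝ := (1 - f t / f X) * f₁ t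

namespace HasConvexGrowth

variable {f f₁ f₂ : ℝ → ℝ} {κ t₀ : ℝ}

theorem continuousOn (hf : HasConvexGrowth f f₁ f₂ κ t₀) : ContinuousOn f (Set.Ici t₀) :=
  fun x hx => (hf.hasDerivAt x hx).continuousAt.continuousWithinAt

theorem continuousOn_deriv (hf : HasConvexGrowth f f₁ f₂ κ t₀) : ContinuousOn f₁ (Set.Ici t₀) :=
  fun x hx => (hf.hasDerivAt_deriv x hx).continuousAt.continuousWithinAt

theorem continuousOn_weight (hf : HasConvexGrowth f f₁ f₂ κ t₀) (X : ℝ) :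
    ContinuousOn (growthWeight f f₁ X) (Set.Ici t₀) :=
  (continuousOn_const.sub (hf.continuousOn.div_const _)).mul hf.continuousOn_deriv

theorem weight_nonneg (hf : HasConvexGrowth f f₁ f₂ κ t₀) {t X : ℝ} (ht : t₀ ≤ t) (hX : t ≤ X) :
    0 ≤ growthWeight f f₁ X t := by
  have h1 := hf.monotoneOn ht (ht.trans hX) hX
  have h2 := hf.one_le X (ht.trans hX)
  refine mul_nonneg ?_ (hf.deriv_pos ht).le
  rw [sub_nonneg, div_le_one (by linarith)]
  exact h1

theorem weight_le (hf : HasConvexGrowth f f₁ f₂ κ t₀) {t X : ℝ} (ht : t₀ ≤ t) (hX : t ≤ X) :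
    growthWeight f f₁ X t ≤ f₁ X := by
  have h2 := hf.one_le X (ht.trans hX)
  have h3 := hf.one_le t ht
  refine le_trans ?_ (hf.monotoneOn_deriv ht (ht.trans hX) hX)
  refine mul_le_of_le_one_left (hf.deriv_pos ht).le ?_
  have : 0 ≤ f t / f X := by positivity
  linarith

theorem abs_weight_sub_le (hf : HasConvexGrowth f f₁ f₂ κ t₀) {b t L X : ℝ} (hb : t₀ ≤ b)
    (hbt : b ≤ t) (htL : t ≤ b + L) (hX : t ≤ X) :
    |growthWeight f f₁ X t - growthWeight f f₁ X b| ≤ L * (f₁ b / b + f₁ X ^ 2 / f X) := by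
  have hX' : t₀ ≤ X := hb.trans (hbt.trans hX)
  have hY : 0 < f X := by linarith [hf.one_le X hX']
  have hder : ∀ x ∈ Set.Icc b t, HasDerivWithinAt (growthWeight f f₁ X)
      ((-(f₁ x / f X)) * f₁ x + (1 - f x / f X) * f₂ x) (Set.Icc b t) x := fun x hx => by
    have h1 := hf.hasDerivAt x (hb.trans hx.1)
    have h2 := hf.hasDerivAt_deriv x (hb.trans hx.1)
    exact (((h1.div_const (f X)).const_sub 1).mul h2).hasDerivWithinAt
  have hbound : ∀ x ∈ Set.Icc b t,
      ‖(-(f₁ x / f X)) * f₁ x + (1 - f x / f X) * f₂ x‖ ≤ f₁ b / b + f₁ X ^ 2 / f X := by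
    intro x hx
    have hx0 := hb.trans hx.1
    have hxX := hx.2.trans hX
    have h0 := hf.pos_of_le hx0
    have hanti := hf.antitoneOn_deriv_div hb hx0 hx.1
    simp only at hanti
    have hup := hf.upper x hx0
    have h2 : f₂ x ≤ f₁ b / b := by
      refine le_trans ?_ hanti
      rw [le_div_iff₀ h0]; linarith
    have h3 := hf.deriv_two_nonneg hx0
    have h4 := hf.monotoneOn_deriv hx0 hX' hxX
    have h5 := hf.deriv_pos hx0
    have h6 : 0 ≤ 1 - f x / f X := by
      rw [sub_nonneg, div_le_one hY]; exact hf.monotoneOn hx0 hX' hxX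
    have h7 : 1 - f x / f X ≤ 1 := by
      have := hf.one_le x hx0
      have : 0 ≤ f x / f X := by positivity
      linarith
    have e1 : ‖(-(f₁ x / f X)) * f₁ x‖ = f₁ x ^ 2 / f X := by
      rw [Real.norm_eq_abs, neg_mul, abs_neg, abs_of_nonneg (by positivity)]; ring
    have e2 : ‖(1 - f x / f X) * f₂ x‖ = (1 - f x / f X) * f₂ x :=
      Real.norm_of_nonneg (mul_nonneg h6 h3)
    refine (norm_add_le _ _).trans ?_
    rw [e1, e2, add_comm]
    gcongr
    nlinarith
  have := (convex_Icc b t).norm_image_sub_le_of_norm_hasDerivWithin_le hder hbound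
    (Set.left_mem_Icc.2 hbt) (Set.right_mem_Icc.2 hbt)
  rw [Real.norm_eq_abs, Real.norm_eq_abs, abs_of_nonneg (sub_nonneg.2 hbt)] at this
  refine this.trans ?_
  rw [mul_comm]
  have h1 := hf.deriv_pos hb
  have h2 := hf.pos_of_le hb
  gcongr
  linarith

theorem abs_sub_linear_le (hf : HasConvexGrowth f f₁ f₂ κ t₀) {b t L : ℝ} (hb : t₀ ≤ b)
    (hbt : b ≤ t) (htL : t ≤ b + L) :
    |f t - (f b + (t - b) * f₁ b)| ≤ L ^ 2 * (f₁ b / b) := by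
  have hL : 0 ≤ L := by linarith
  have hQ : 0 ≤ f₁ b / b := (div_pos (hf.deriv_pos hb) (hf.pos_of_le hb)).le
  have hderiv : ∀ x, b ≤ x → x ≤ t → f₁ x - f₁ b ≤ L * (f₁ b / b) := by
    intro x hbx hxt
    have h := mul_sub_le_sub_of_hasDerivAt (t₀ := t₀) (g := fun t => -f₁ t)
      (g' := fun t => -f₂ t) (C := -(f₁ b / b)) hbx hb
      (fun t ht => (hf.hasDerivAt_deriv t ht).neg) (fun s hs _ => by
        have hs0 := hb.trans hs
        have h1 := hf.antitoneOn_deriv_div hb hs0 hs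
        simp only at h1
        have h2 := hf.upper s hs0
        refine neg_le_neg (le_trans ?_ h1)
        rw [le_div_iff₀ (hf.pos_of_le hs0)]; linarith)
    have : f₁ b / b * (x - b) ≤ f₁ b / b * L := by gcongr; linarith
    linarith
  have hder : ∀ x ∈ Set.Icc b t, HasDerivWithinAt (fun s => f s - (f b + (s - b) * f₁ b))
      (f₁ x - f₁ b) (Set.Icc b t) x := fun x hx => by
    have h1 := hf.hasDerivAt x (hb.trans hx.1)
    have h2 : HasDerivAt (fun s : ℝ => f b + (s - b) * f₁ b) (f₁ b) x := by
      simpa using (((hasDerivAt_id x).sub_const b).mul_const (f₁ b)).const_add (f b)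
    exact (h1.sub h2).hasDerivWithinAt
  have := (convex_Icc b t).norm_image_sub_le_of_norm_hasDerivWithin_le hder
    (C := L * (f₁ b / b)) (fun x hx => by
      rw [Real.norm_eq_abs, abs_of_nonneg (sub_nonneg.2
        (hf.monotoneOn_deriv hb (hb.trans hx.1) hx.1))]
      exact hderiv x hx.1 hx.2)
    (Set.left_mem_Icc.2 hbt) (Set.right_mem_Icc.2 hbt)
  simp only [sub_self, zero_mul, add_zero, sub_zero, Real.norm_eq_abs,
    abs_of_nonneg (sub_nonneg.2 hbt)] at this
  calc _ ≤ L * (f₁ b / b) * (t - b) := this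
    _ ≤ L * (f₁ b / b) * L := by gcongr; linarith
    _ = L ^ 2 * (f₁ b / b) := by ring

/-- The weighted exponential with frequency `θ` along `f`. -/
noncomputable def wave (f f₁ : ℝ → ℝ) (X θ t : ℝ) : ℂ :=
  (growthWeight f f₁ X t : ℂ) * unitExp (θ * f t)

theorem continuousOn_wave (hf : HasConvexGrowth f f₁ f₂ κ t₀) (X θ : ℝ) :
    ContinuousOn (wave f f₁ X θ) (Set.Ici t₀) :=
  (Complex.continuous_ofReal.comp_continuousOn (hf.continuousOn_weight X)).mul
    (continuous_unitExp.comp_continuousOn (continuousOn_const.mul hf.continuousOn))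

theorem norm_wave_sub_linear_le (hf : HasConvexGrowth f f₁ f₂ κ t₀) {b s L X : ℝ} (θ : ℝ)
    (hb : t₀ ≤ b) (hs : 0 ≤ s) (hsL : s ≤ L) (hX : b + L ≤ X) :
    ‖wave f f₁ X θ (b + s) - wave f f₁ X θ b * unitExp (θ * f₁ b * s)‖ ≤
      L * (f₁ b / b + f₁ X ^ 2 / f X) +
        2 * Real.pi * |θ| * f₁ X * (L ^ 2 * (f₁ b / b)) := by
  have hbX : b ≤ X := by linarith
  have h1 := hf.abs_weight_sub_le (L := L) (X := X) hb (show b ≤ b + s by linarith)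
    (by linarith) (by linarith)
  have h2 := hf.abs_sub_linear_le (L := L) hb (show b ≤ b + s by linarith) (by linarith)
  rw [add_sub_cancel_left] at h2
  have e : wave f f₁ X θ (b + s) - wave f f₁ X θ b * unitExp (θ * f₁ b * s) =
      ((growthWeight f f₁ X (b + s) - growthWeight f f₁ X b : ℝ) : ℂ) * unitExp (θ * f (b + s)) +
      (growthWeight f f₁ X b : ℂ) *
        (unitExp (θ * f (b + s)) - unitExp (θ * (f b + s * f₁ b))) := by
    have : unitExp (θ * (f b + s * f₁ b)) = unitExp (θ * f b) * unitExp (θ * f₁ b * s) := by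
      rw [← unitExp_add]; congr 1; ring
    rw [this, wave, wave]; push_cast; ring
  rw [e]
  refine (norm_add_le _ _).trans (add_le_add ?_ ?_)
  · rw [norm_mul, norm_unitExp, mul_one, Complex.norm_real]; exact h1
  · rw [norm_mul, Complex.norm_real, Real.norm_of_nonneg (hf.weight_nonneg hb hbX)]
    have h3 := norm_unitExp_sub_le (θ * f (b + s)) (θ * (f b + s * f₁ b))
    rw [← mul_sub, abs_mul] at h3
    have hpi := Real.pi_pos
    have hD := hf.deriv_pos (hb.trans hbX)
    calc _ ≤ f₁ X * (2 * Real.pi * (|θ| * (L ^ 2 * (f₁ b / b)))) := by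
          refine mul_le_mul (hf.weight_le hb hbX) (h3.trans ?_) (norm_nonneg _) hD.le
          gcongr
      _ = _ := by ring

/-- Freezing the weight and linearising the phase at b costs the same in the sum and in the
integral, whence the factor 2. What remains is a geometric sum with frequency θf'(b). -/
theorem norm_block_le (hf : HasConvexGrowth f f₁ f₂ κ t₀) {b X : ℝ} (L : ℕ) (θ : ℝ)
    (hb : t₀ ≤ b) (hX : b + L ≤ X) :
    ‖∑ j ∈ Finset.range L, wave f f₁ X θ (b + j) - ∫ t in b..(b + L), wave f f₁ X θ t‖ ≤
      2 * L * (L * (f₁ b / b + f₁ X ^ 2 / f X) +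
        2 * Real.pi * |θ| * f₁ X * (L ^ 2 * (f₁ b / b))) +
      f₁ X * ‖∑ j ∈ Finset.range L, unitExp (j * (θ * f₁ b)) -
        ∫ s in (0 : ℝ)..L, unitExp (θ * f₁ b * s)‖ := by
  set K := L * (f₁ b / b + f₁ X ^ 2 / f X) + 2 * Real.pi * |θ| * f₁ X * (L ^ 2 * (f₁ b / b))
    with hK
  have hL0 : (0 : ℝ) ≤ L := Nat.cast_nonneg L
  have hbX : b ≤ X := by linarith
  have hshift : ∫ t in b..(b + L), wave f f₁ X θ t =
      ∫ s in (0 : ℝ)..L, wave f f₁ X θ (b + s) := by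
    rw [intervalIntegral.integral_comp_add_left (fun t => wave f f₁ X θ t), add_zero]
  have hint : IntervalIntegrable (fun s => wave f f₁ X θ (b + s)) MeasureTheory.volume 0 L := by
    refine ContinuousOn.intervalIntegrable ?_
    rw [Set.uIcc_of_le hL0]
    refine (hf.continuousOn_wave X θ).comp (by fun_prop) fun s hs => ?_
    exact Set.mem_Ici.2 (by linarith [hs.1])
  have hint2 : IntervalIntegrable (fun s => wave f f₁ X θ b * unitExp (θ * f₁ b * s))
      MeasureTheory.volume 0 L := Continuous.intervalIntegrable (by fun_prop) _ _
  have hsum : ‖∑ j ∈ Finset.range L, (wave f f₁ X θ (b + j) -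
      wave f f₁ X θ b * unitExp (θ * f₁ b * j))‖ ≤ L * K := by
    refine (norm_sum_le _ _).trans
      ((Finset.sum_le_sum (g := fun _ => K) fun j hj => ?_).trans_eq ?_)
    · have : (j : ℝ) ≤ L := by exact_mod_cast (Finset.mem_range.1 hj).le
      exact hf.norm_wave_sub_linear_le θ hb (Nat.cast_nonneg j) this hX
    · simp
  have hintegral : ‖∫ s in (0 : ℝ)..L, (wave f f₁ X θ (b + s) -
      wave f f₁ X θ b * unitExp (θ * f₁ b * s))‖ ≤ K * L := by
    have := intervalIntegral.norm_integral_le_of_norm_le_const (a := 0) (b := (L : ℝ)) (C := K)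
      (f := fun s : ℝ => wave f f₁ X θ (b + s) - wave f f₁ X θ b * unitExp (θ * f₁ b * s))
      (fun s hs => by
        rw [Set.uIoc_of_le hL0] at hs
        exact hf.norm_wave_sub_linear_le θ hb hs.1.le hs.2 hX)
    rwa [sub_zero, abs_of_nonneg hL0] at this
  have e : ∑ j ∈ Finset.range L, wave f f₁ X θ (b + j) - ∫ t in b..(b + L), wave f f₁ X θ t =
      ∑ j ∈ Finset.range L, (wave f f₁ X θ (b + j) -
        wave f f₁ X θ b * unitExp (θ * f₁ b * j)) -
      (∫ s in (0 : ℝ)..L, (wave f f₁ X θ (b + s) - wave f f₁ X θ b * unitExp (θ * f₁ b * s))) +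
      wave f f₁ X θ b * (∑ j ∈ Finset.range L, unitExp (j * (θ * f₁ b)) -
        ∫ s in (0 : ℝ)..L, unitExp (θ * f₁ b * s)) := by
    rw [hshift, intervalIntegral.integral_sub hint hint2, intervalIntegral.integral_const_mul,
      Finset.sum_sub_distrib, ← Finset.mul_sum]
    simp_rw [mul_comm (_ : ℝ) (θ * f₁ b)]
    ring
  rw [e]
  refine (norm_add_le _ _).trans (add_le_add ?_ ?_)
  · refine (norm_sub_le _ _).trans ?_
    linarith
  · rw [norm_mul, wave, norm_mul, norm_unitExp, mul_one, Complex.norm_real,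
      Real.norm_of_nonneg (hf.weight_nonneg hb hbX)]
    exact mul_le_mul_of_nonneg_right (hf.weight_le hb hbX) (norm_nonneg _)

end HasConvexGrowth

/-! ### Exponential sums along f, assembled from blocks. -/

namespace HasConvexGrowth

variable {f f₁ f₂ : ℝ → ℝ} {κ t₀ : ℝ}

/-- By `gap_le` each term with i ≥ 2 is at most the increment of f' over the preceding block divided
by κ, so the sum telescopes and no logarithm is lost. -/
theorem sum_deriv_div_le (hf : HasConvexGrowth f f₁ f₂ κ t₀) {L : ℕ} (hL : t₀ ≤ L) (p : ℕ) :
    ∑ i ∈ Finset.Ico 1 (p + 2), (L : ℝ) * (f₁ (i * L) / (i * L)) ≤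
      f₁ L + f₁ ((p + 1 : ℕ) * L) / κ := by
  have hL0 := hf.pos_of_le hL
  induction p with
  | zero =>
    have h1 := hf.deriv_pos hL
    have h2 := hf.pos
    simp only [zero_add, Finset.sum_Ico_eq_sum_range, Nat.add_one_sub_one, Finset.sum_range_one,
      Nat.cast_one, one_mul, Nat.cast_add, Nat.cast_zero, add_zero]
    rw [mul_div_cancel₀ _ hL0.ne']
    have : 0 ≤ f₁ L / κ := by positivity
    linarith
  | succ p ih =>
    rw [Finset.sum_Ico_succ_top (by omega)]
    have hb : t₀ ≤ ((p + 1 : ℕ) : ℝ) * L := by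
      refine hL.trans (le_mul_of_one_le_left hL0.le ?_)
      push_cast; linarith [(Nat.cast_nonneg p : (0 : ℝ) ≤ p)]
    have e : ((p + 1 : ℕ) : ℝ) * L + L = ((p + 1 + 1 : ℕ) : ℝ) * L := by push_cast; ring
    have hgap := hf.gap_le hb hL0.le le_rfl
    rw [e] at hgap
    have h3 : (L : ℝ) * (f₁ (((p + 1 + 1 : ℕ) : ℝ) * L) / (((p + 1 + 1 : ℕ) : ℝ) * L)) ≤
        (f₁ (((p + 1 + 1 : ℕ) : ℝ) * L) - f₁ (((p + 1 : ℕ) : ℝ) * L)) / κ := by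
      rw [le_div_iff₀ hf.pos]; linarith
    rw [sub_div] at h3
    linarith

/-- The starting points of the blocks whose frequency is close to a non-zero integer are few. -/
theorem card_bad_blocks_le (hf : HasConvexGrowth f f₁ f₂ κ t₀) {L q : ℕ} (hL : t₀ ≤ L)
    (hq1 : 1 ≤ q) {ρ : ℝ} (hρ : 0 < ρ) (hρ2 : ρ ≤ 1 / 2) (θ : ℝ) {s : Finset ℕ} (hs : s ⊆ Finset.Ico 1 q)
    (hbad : ∀ i ∈ s, ∃ m : ℤ, m ≠ 0 ∧ |θ * f₁ (i * L) - m| < ρ) :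
    (s.card : ℝ) ≤ 4 * ρ * q / κ + 2 * |θ| * f₁ (q * L) := by
  have hL0 := hf.pos_of_le hL
  have hle : ∀ i : ℕ, 1 ≤ i → t₀ ≤ (i : ℝ) * L := fun i hi =>
    hL.trans (le_mul_of_one_le_left hL0.le (by exact_mod_cast hi))
  have hX := hle q hq1
  have hX0 := hf.pos_of_le hX
  have hD := hf.deriv_pos hX
  have hκ := hf.pos
  rcases s.eq_empty_or_nonempty with rfl | ⟨i₀, hi₀⟩
  · rw [Finset.card_empty, Nat.cast_zero]; positivity
  -- Frequency 0 has no bad blocks, and otherwise the spacing g is positive.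
  have hθ : θ ≠ 0 := by
    rintro rfl
    obtain ⟨m, hm, h⟩ := hbad i₀ hi₀
    rw [zero_mul, zero_sub, abs_neg] at h
    have : (1 : ℝ) ≤ |(m : ℝ)| := by exact_mod_cast Int.one_le_abs hm
    linarith
  have hθ0 : 0 < |θ| := abs_pos.2 hθ
  set D := f₁ (q * L) with hDdef
  have hqL : (q : ℝ) ≠ 0 := by positivity
  set g := |θ| * (L * (κ * (D / (q * L)))) with hg
  have hg0 : 0 < g := by positivity
  have hgap : ∀ i ∈ s, ∀ j ∈ s, i ≤ j →
      ((j : ℝ) - i) * g ≤ |θ| * f₁ (j * L) - |θ| * f₁ (i * L) := by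
    intro i hi j hj hij
    have hi' := Finset.mem_Ico.1 (hs hi)
    have hj' := Finset.mem_Ico.1 (hs hj)
    have hij' : (i : ℝ) ≤ j := by exact_mod_cast hij
    have hjq : (j : ℝ) ≤ q := by exact_mod_cast hj'.2.le
    have h := hf.gap_le (b := i * L) (L := (j - i) * L) (X := q * L) (hle i hi'.1)
      (mul_nonneg (by linarith) hL0.le) (by nlinarith)
    rw [show (i : ℝ) * L + (j - i) * L = j * L by ring] at h
    rw [← mul_sub]
    calc ((j : ℝ) - i) * g = |θ| * ((j - i) * L * (κ * (D / (q * L)))) := by rw [hg]; ring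
      _ ≤ _ := mul_le_mul_of_nonneg_left h hθ0.le
  have hB : ∀ i ∈ s, |θ| * f₁ (i * L) ≤ |θ| * D := by
    intro i hi
    have hi' := Finset.mem_Ico.1 (hs hi)
    have hiq : (i : ℝ) ≤ q := by exact_mod_cast hi'.2.le
    exact mul_le_mul_of_nonneg_left
      (hf.monotoneOn_deriv (hle i hi'.1) hX (mul_le_mul_of_nonneg_right hiq hL0.le)) hθ0.le
  have hnear : ∀ i ∈ s, ∃ m : ℕ, 1 ≤ m ∧ |(|θ| * f₁ (i * L)) - m| < ρ := by
    intro i hi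
    have hi' := Finset.mem_Ico.1 (hs hi)
    obtain ⟨m, hm, h⟩ := hbad i hi
    refine ⟨m.natAbs, by omega, ?_⟩
    have h2 := abs_abs_sub_abs_le_abs_sub (θ * f₁ (i * L)) m
    rw [abs_mul, abs_of_pos (hf.deriv_pos (hle i hi'.1))] at h2
    rw [Nat.cast_natAbs, Int.cast_abs]
    exact h2.trans_lt h
  have hcard := card_near_integer_le hg0 hρ hρ2 hgap hB (by positivity) hnear
  refine hcard.trans_eq ?_
  rw [hg]
  field_simp
  ring

/-- The terms come, in order, from the variation of f' and the curvature of the phase, from the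
variation of 1 - f/f(X), from the non-resonant blocks, and from the resonant blocks estimated
trivially. -/
theorem norm_sum_wave_sub_integral_le (hf : HasConvexGrowth f f₁ f₂ κ t₀) {L q : ℕ}
    (hL : t₀ ≤ L) (hq : 2 ≤ q) {ρ : ℝ} (hρ : 0 < ρ) (hρ2 : ρ ≤ 1 / 2) (θ : ℝ) :
    ‖∑ n ∈ Finset.Ico L (q * L), wave f f₁ (q * L) θ n -
      ∫ t in (L : ℝ)..(q * L), wave f f₁ (q * L) θ t‖ ≤
      (2 * L + 4 * Real.pi * |θ| * f₁ (q * L) * L ^ 2) * (f₁ (q * L) * (1 + κ⁻¹)) +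
      2 * q * L ^ 2 * (f₁ (q * L) ^ 2 / f (q * L)) +
      q * f₁ (q * L) * (2 / ρ) +
      2 * L * f₁ (q * L) * (4 * ρ * q / κ + 2 * |θ| * f₁ (q * L)) := by
  have hL0 := hf.pos_of_le hL
  have hle : ∀ i : ℕ, 1 ≤ i → t₀ ≤ (i : ℝ) * L := fun i hi =>
    hL.trans (le_mul_of_one_le_left hL0.le (by exact_mod_cast hi))
  have hX := hle q (by omega)
  set X : ℝ := q * L with hXdef
  set D := f₁ X with hDdef
  have hD : 0 < D := hf.deriv_pos hX
  have hκ := hf.pos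
  set R : ℝ := D ^ 2 / f X with hR
  have hR0 : 0 ≤ R := div_nonneg (sq_nonneg _) (by linarith [hf.one_le X hX])
  have hpi := Real.pi_pos
  have hθ0 := abs_nonneg θ
  -- decomposition into blocks
  have hsum : ∑ n ∈ Finset.Ico L (q * L), wave f f₁ X θ n =
      ∑ i ∈ Finset.Ico 1 q, ∑ j ∈ Finset.range L, wave f f₁ X θ (i * L + j) := by
    have := sum_Ico_mul_eq_sum_sum (fun n => wave f f₁ X θ n) L (show 1 ≤ q by omega)
    rw [one_mul] at this
    rw [this]
    push_cast; rfl
  have hstep : ∀ i : ℕ, (i : ℝ) * L + L = ((i + 1 : ℕ) : ℝ) * L := fun i => by push_cast; ring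
  have hint : ∫ t in (L : ℝ)..X, wave f f₁ X θ t =
      ∑ i ∈ Finset.Ico 1 q, ∫ t in (i * L : ℝ)..(i * L + L), wave f f₁ X θ t := by
    have := intervalIntegral.sum_integral_adjacent_intervals_Ico (μ := MeasureTheory.volume)
      (f := wave f f₁ X θ) (a := fun i : ℕ => (i : ℝ) * L) (show 1 ≤ q by omega)
      (fun i hi => by
        refine ContinuousOn.intervalIntegrable ((hf.continuousOn_wave X θ).mono ?_)
        have h1 : (i : ℝ) * L ≤ ((i + 1 : ℕ) : ℝ) * L := by rw [← hstep]; linarith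
        rw [Set.uIcc_of_le h1]
        exact fun t ht => (hle i hi.1).trans ht.1)
    rw [Nat.cast_one, one_mul] at this
    rw [← this]
    simp_rw [hstep]
  rw [hsum, hint, ← Finset.sum_sub_distrib]
  set geo : ℕ → ℝ := fun i => ‖∑ j ∈ Finset.range L, unitExp (j * (θ * f₁ (i * L))) -
        ∫ s in (0 : ℝ)..L, unitExp (θ * f₁ (i * L) * s)‖ with hgeo
  have hblock : ∀ i ∈ Finset.Ico 1 q,
      ‖∑ j ∈ Finset.range L, wave f f₁ X θ (i * L + j) -
        ∫ t in (i * L : ℝ)..(i * L + L), wave f f₁ X θ t‖ ≤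
      (2 * L + 4 * Real.pi * |θ| * D * L ^ 2) * (L * (f₁ (i * L) / (i * L))) +
        2 * L ^ 2 * R + D * geo i := by
    intro i hi
    have hi' := Finset.mem_Ico.1 hi
    have hiq : ((i + 1 : ℕ) : ℝ) ≤ q := by exact_mod_cast hi'.2
    refine (hf.norm_block_le L θ (hle i hi'.1)
      (by rw [hstep]; exact mul_le_mul_of_nonneg_right hiq hL0.le)).trans_eq ?_
    ring
  -- the blocks close to a resonance
  classical
  set bad : Finset ℕ := {i ∈ Finset.Ico 1 q | ∃ m : ℤ, m ≠ 0 ∧ |θ * f₁ (i * L) - m| < ρ}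
    with hbad
  have hcard := hf.card_bad_blocks_le hL (show 1 ≤ q by omega) hρ hρ2 θ (s := bad) (Finset.filter_subset _ _)
    (fun i hi => (Finset.mem_filter.1 hi).2)
  have hgeo_le : ∀ i ∈ Finset.Ico 1 q, geo i ≤ 2 / ρ + if i ∈ bad then 2 * (L : ℝ) else 0 := by
    intro i hi
    split_ifs with hib
    · have := norm_sum_unitExp_sub_integral_le_two_mul (θ * f₁ (i * L)) L
      have h2 : 0 ≤ 2 / ρ := by positivity
      simp only [hgeo]; linarith
    · rw [add_zero]
      refine norm_sum_unitExp_sub_integral_le hρ hρ2 L fun m hm => ?_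
      by_contra hcon
      exact hib (Finset.mem_filter.2 ⟨hi, m, hm, not_le.1 hcon⟩)
  have hgeo_sum : ∑ i ∈ Finset.Ico 1 q, geo i ≤
      q * (2 / ρ) + 2 * L * (4 * ρ * q / κ + 2 * |θ| * D) := by
    refine (Finset.sum_le_sum hgeo_le).trans ?_
    rw [Finset.sum_add_distrib, ← Finset.sum_filter, Finset.sum_const, Finset.sum_const,
      Nat.card_Ico, nsmul_eq_mul, nsmul_eq_mul]
    have e : ({i ∈ Finset.Ico 1 q | i ∈ bad} : Finset ℕ) = bad := by
      ext i; simp only [hbad, Finset.mem_filter]; tauto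
    rw [e, mul_comm (bad.card : ℝ)]
    have h3 : ((q - 1 : ℕ) : ℝ) ≤ q := by exact_mod_cast Nat.sub_le q 1
    gcongr
  obtain ⟨p, rfl⟩ : ∃ p, q = p + 2 := ⟨q - 2, by omega⟩
  have hQ : ∑ i ∈ Finset.Ico 1 (p + 2), (L : ℝ) * (f₁ (i * L) / (i * L)) ≤ D * (1 + κ⁻¹) := by
    refine (hf.sum_deriv_div_le hL p).trans ?_
    have h1 : f₁ L ≤ D := hf.monotoneOn_deriv hL hX
      (le_mul_of_one_le_left hL0.le (by push_cast; linarith [(Nat.cast_nonneg p : (0 : ℝ) ≤ p)]))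
    have h2 : f₁ ((p + 1 : ℕ) * L) ≤ D := hf.monotoneOn_deriv (hle _ (by omega)) hX
      (mul_le_mul_of_nonneg_right (by push_cast; linarith) hL0.le)
    rw [mul_add, mul_one, ← div_eq_mul_inv]
    gcongr
  refine (norm_sum_le _ _).trans ((Finset.sum_le_sum hblock).trans ?_)
  rw [Finset.sum_add_distrib, Finset.sum_add_distrib, Finset.sum_const, Nat.card_Ico, nsmul_eq_mul]
  have h4 : ((p + 2 - 1 : ℕ) : ℝ) * (2 * L ^ 2 * R) ≤ 2 * (p + 2 : ℕ) * L ^ 2 * R := by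
    have : ((p + 2 - 1 : ℕ) : ℝ) ≤ (p + 2 : ℕ) := by exact_mod_cast Nat.sub_le _ 1
    calc _ ≤ ((p + 2 : ℕ) : ℝ) * (2 * L ^ 2 * R) := by gcongr
      _ = _ := by ring
  have h5 := mul_le_mul_of_nonneg_left hgeo_sum hD.le
  have h6 := mul_le_mul_of_nonneg_left hQ
    (show 0 ≤ 2 * (L : ℝ) + 4 * Real.pi * |θ| * D * L ^ 2 by positivity)
  rw [Finset.mul_sum] at h5 h6
  linarith

/-- Sums of exponentials along a function of convex growth are close to integrals. -/
theorem exists_norm_sum_wave_sub_integral_le (hf : HasConvexGrowth f f₁ f₂ κ t₀) :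
    ∃ C : ℝ, 0 < C ∧ ∀ r : ℕ, 2 ≤ r → 2 * t₀ ≤ r → ∀ θ : ℝ,
      ‖∑ n ∈ Finset.Ico (r ^ 2) (r ^ 5), wave f f₁ (r ^ 5) θ n -
        ∫ t in (r ^ 2 : ℝ)..(r ^ 5), wave f f₁ (r ^ 5) θ t‖ ≤
      C * (1 + |θ|) * (r ^ 4 * f₁ (r ^ 5) ^ 2) := by
  have hκ := hf.pos
  have hpi := Real.pi_pos
  refine ⟨(2 + 4 * Real.pi) * (1 + κ⁻¹) + 8 + 2 + (8 / κ + 4), by positivity, ?_⟩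
  intro r hr hrt θ
  have hr1 : (2 : ℝ) ≤ r := by exact_mod_cast hr
  have hr0 : (0 : ℝ) < r := by linarith
  have ht1 := hf.one_le_start
  have hrL : t₀ ≤ ((r ^ 2 : ℕ) : ℝ) := by push_cast; nlinarith
  -- In terms of X = qL, the competing errors L², q/ρ and ρqL, up to powers of D, are balanced by L
  -- = X^(2/5), ρ = X^(-1/5); all equal r⁴ when X = r⁵.
  have hmain := hf.norm_sum_wave_sub_integral_le (L := r ^ 2) (q := r ^ 3) (ρ := 1 / r) hrL
    (by nlinarith [Nat.pow_le_pow_left hr 3]) (by positivity) (one_div_le_one_div_of_le two_pos hr1) θ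
  have e1 : r ^ 3 * r ^ 2 = r ^ 5 := by ring
  have e2 : ((r ^ 3 : ℕ) : ℝ) * ((r ^ 2 : ℕ) : ℝ) = (r : ℝ) ^ 5 := by push_cast; ring
  rw [e1, e2] at hmain
  push_cast at hmain
  have hr25 : (r : ℝ) ≤ r ^ 5 := le_self_pow₀ (by linarith) (by norm_num)
  have hX : 2 * t₀ ≤ (r : ℝ) ^ 5 := hrt.trans hr25
  have hXt : t₀ ≤ (r : ℝ) ^ 5 := by linarith
  have hY := hf.mul_deriv_le hX
  have hD1 := hf.one_le_deriv _ hXt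
  set D := f₁ ((r : ℝ) ^ 5) with hD
  set Y := f ((r : ℝ) ^ 5) with hYdef
  have hD0 : 0 < D := by linarith
  have hY0 : 0 < Y := by linarith [hf.one_le _ hXt]
  refine hmain.trans ?_
  have hθ0 := abs_nonneg θ
  set x := |θ|
  set M := (1 + x) * ((r : ℝ) ^ 4 * D ^ 2) with hM
  have hDD : D ≤ D ^ 2 := by nlinarith
  have hr24 : (r : ℝ) ^ 2 ≤ r ^ 4 := pow_le_pow_right₀ (by linarith) (by norm_num)
  have hbase : (r : ℝ) ^ 2 * D ^ 2 ≤ r ^ 4 * D ^ 2 := by gcongr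
  have hbase2 : (r : ℝ) ^ 4 * D ≤ r ^ 4 * D ^ 2 := by gcongr
  have hbase3 : (r : ℝ) ^ 2 * D ≤ r ^ 4 * D ^ 2 := by gcongr
  have hMb : (r : ℝ) ^ 4 * D ^ 2 ≤ M := by
    rw [hM]; exact le_mul_of_one_le_left (by positivity) (by linarith)
  have hMx : x * ((r : ℝ) ^ 4 * D ^ 2) ≤ M := by
    rw [hM]; gcongr; linarith
  have t1 : (2 * (r : ℝ) ^ 2 + 4 * Real.pi * x * D * (r ^ 2) ^ 2) * (D * (1 + κ⁻¹)) ≤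
      (2 + 4 * Real.pi) * (1 + κ⁻¹) * M := by
    calc _ = (2 * (r ^ 2 * D) + 4 * Real.pi * (x * (r ^ 4 * D ^ 2))) * (1 + κ⁻¹) := by ring
      _ ≤ (2 * M + 4 * Real.pi * M) * (1 + κ⁻¹) := by gcongr; linarith
      _ = _ := by ring
  have t2 : 2 * (r : ℝ) ^ 3 * (r ^ 2) ^ 2 * (D ^ 2 / Y) ≤ 8 * M := by
    have h1 : (r : ℝ) ^ 5 / Y ≤ 4 / D := by
      rw [div_le_div_iff₀ hY0 hD0]; linarith
    calc _ = 2 * (r ^ 2 * D ^ 2) * (r ^ 5 / Y) := by ring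
      _ ≤ 2 * (r ^ 2 * D ^ 2) * (4 / D) := by gcongr
      _ = 8 * (r ^ 2 * D) := by field_simp; ring
      _ ≤ 8 * M := by linarith
  have t3 : (r : ℝ) ^ 3 * D * (2 / (1 / r)) ≤ 2 * M := by
    calc _ = 2 * (r ^ 4 * D) := by field_simp
      _ ≤ 2 * M := by linarith
  have t4 : 2 * (r : ℝ) ^ 2 * D * (4 * (1 / r) * r ^ 3 / κ + 2 * x * D) ≤ (8 / κ + 4) * M := by
    calc _ = 8 / κ * (r ^ 4 * D) + 4 * (x * (r ^ 2 * D ^ 2)) := by field_simp; ring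
      _ ≤ 8 / κ * M + 4 * (x * (r ^ 4 * D ^ 2)) := by gcongr; linarith
      _ ≤ 8 / κ * M + 4 * M := by linarith
      _ = _ := by ring
  calc _ ≤ (2 + 4 * Real.pi) * (1 + κ⁻¹) * M + 8 * M + 2 * M + (8 / κ + 4) * M := by
        linarith
    _ = _ := by rw [hM]; ring

end HasConvexGrowth

/-! ### From a one-sided bound to a cosine polynomial; triangular averages. -/

/-- Adding E makes the sum non-negative, and dividing by the value at 0 normalises it. Equal
frequencies are collected into one coefficient, and a term with zero weight may have a frequency
outside S. -/
theorem vdcQuantity_le_of_sum_cos_ge {S : Set ℤ} {N : ℕ} {I : Finset ℕ} {v : ℕ → ℝ} {m : ℕ → ℕ}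
    {E : ℝ} (hm : ∀ n ∈ I, 1 ≤ m n ∧ m n ≤ N) (hS : ∀ n ∈ I, v n = 0 ∨ (m n : ℤ) ∈ S)
    (hge : ∀ ξ : ℝ, -E ≤ ∑ n ∈ I, v n * Real.cos (2 * Real.pi * m n * ξ))
    (hpos : 0 < ∑ n ∈ I, v n + E) :
    vdcQuantity S N ≤ E / (∑ n ∈ I, v n + E) := by
  set W := ∑ n ∈ I, v n + E with hW
  set a : ℕ → ℝ := fun k => if k = 0 then E / W else ∑ n ∈ I with m n = k, v n / W with ha
  have hpoly : ∀ ξ, cosPoly N a ξ =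
      (E + ∑ n ∈ I, v n * Real.cos (2 * Real.pi * m n * ξ)) / W := by
    intro ξ
    have h1 : ∀ k ∈ Finset.Icc 1 N, a k * Real.cos (2 * Real.pi * k * ξ) =
        ∑ n ∈ I with m n = k, v n * Real.cos (2 * Real.pi * m n * ξ) / W := by
      intro k hk
      have hk0 : k ≠ 0 := by have := (Finset.mem_Icc.1 hk).1; omega
      simp only [ha, if_neg hk0, Finset.sum_mul]
      refine Finset.sum_congr rfl fun n hn => ?_
      rw [(Finset.mem_filter.1 hn).2]; ring
    rw [cosPoly, Finset.sum_congr rfl h1, Finset.sum_fiberwise_of_maps_to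
      (fun n hn => Finset.mem_Icc.2 (hm n hn)), ← Finset.sum_div, add_div]
    simp [ha]
  have hvdc : IsVdCPolynomial (S ∩ Set.Icc 1 (N : ℤ)) N a := by
    refine ⟨fun ξ => ?_, ?_, fun k hk hkS => ?_⟩
    · rw [hpoly]
      exact div_nonneg (by linarith [hge ξ]) hpos.le
    · rw [hpoly]
      simp only [mul_zero, Real.cos_zero, mul_one]
      rw [add_comm, ← hW, div_self hpos.ne']
    · have hk' := Finset.mem_Icc.1 hk
      have hk0 : k ≠ 0 := by omega
      simp only [ha, if_neg hk0]
      refine Finset.sum_eq_zero fun n hn => ?_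
      obtain ⟨hnI, hnk⟩ := Finset.mem_filter.1 hn
      rcases hS n hnI with h | h
      · rw [h, zero_div]
      · rw [hnk] at h
        exact absurd ⟨h, by exact_mod_cast hk'.1, by exact_mod_cast hk'.2⟩ hkS
  have := vdcQuantity_le hvdc
  simpa [ha] using this

theorem integral_sin_pi_mul_sq (m : ℕ) :
    ∫ y in (m : ℝ)..(m + 1 : ℕ), Real.sin (Real.pi * y) ^ 2 = 1 / 2 := by
  have hpi := Real.pi_pos
  have hder : ∀ y : ℝ, HasDerivAt (fun y => y / 2 - Real.sin (2 * Real.pi * y) / (4 * Real.pi))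
      (Real.sin (Real.pi * y) ^ 2) y := by
    intro y
    have h1 : HasDerivAt (fun y : ℝ => 2 * Real.pi * y) (2 * Real.pi) y := by
      simpa using (hasDerivAt_id y).const_mul (2 * Real.pi)
    have h2 := ((hasDerivAt_id y).div_const 2).sub (h1.sin.div_const (4 * Real.pi))
    convert! h2 using 1
    rw [Real.sin_sq_eq_half_sub, ← mul_assoc]
    field_simp
    ring
  rw [intervalIntegral.integral_eq_sub_of_hasDerivAt (fun y _ => hder y)
    (Continuous.intervalIntegrable (by fun_prop) _ _)]
  have hs : ∀ n : ℕ, Real.sin (2 * Real.pi * n) = 0 := fun n => by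
    have := Real.sin_nat_mul_pi (2 * n)
    push_cast at this
    rw [← this]; ring_nf
  rw [hs, hs]; push_cast; ring

theorem integral_floorWave (ξ : ℝ) (m : ℕ) :
    ∫ y in (m : ℝ)..(m + 1 : ℕ), floorWave ξ y = 1 / 2 * unitExp (ξ * m) := by
  have h : ∫ y in (m : ℝ)..(m + 1 : ℕ), floorWave ξ y =
      ∫ y in (m : ℝ)..(m + 1 : ℕ), ((Real.sin (Real.pi * y) ^ 2 : ℝ) : ℂ) * unitExp (ξ * m) := by
    refine intervalIntegral.integral_congr_Ioo_of_le (by push_cast; linarith) fun y hy => ?_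
    have hfl : ⌊y⌋ = (m : ℤ) := by
      rw [Int.floor_eq_iff]
      have := hy.2
      push_cast at this ⊢
      exact ⟨hy.1.le, this⟩
    rw [floorWave, hfl, Int.cast_natCast]
  rw [h, intervalIntegral.integral_mul_const, intervalIntegral.integral_ofReal,
    integral_sin_pi_mul_sq]
  push_cast; ring

/-- The triangular average of `floorWave` is close to a Fejér type sum. -/
theorem norm_integral_floorWave_sub_sum_le {ξ y₀ Y : ℝ} (h0 : 0 ≤ ξ) (h1 : ξ < 1) (hy0 : 0 ≤ y₀)
    (hyY : y₀ ≤ Y) (hY : 1 ≤ Y) :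
    ‖(∫ y in y₀..Y, ((1 - y / Y : ℝ) : ℂ) * floorWave ξ y) -
      ∑ m ∈ Finset.range ⌊Y⌋₊, (((1 - m / Y) / 2 : ℝ) : ℂ) * unitExp (ξ * m)‖ ≤ y₀ + 2 := by
  have hY0 : 0 < Y := by linarith
  have hcont : Continuous fun y : ℝ => ((1 - y / Y : ℝ) : ℂ) * floorWave ξ y := by
    have := continuous_floorWave h0 h1
    have h2 : Continuous fun y : ℝ => ((1 - y / Y : ℝ) : ℂ) := by fun_prop
    exact h2.mul this
  have hint : ∀ a b : ℝ, IntervalIntegrable (fun y : ℝ => ((1 - y / Y : ℝ) : ℂ) * floorWave ξ y)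
      MeasureTheory.volume a b := fun a b => hcont.intervalIntegrable a b
  have hnorm : ∀ y : ℝ, 0 ≤ y → y ≤ Y → ‖((1 - y / Y : ℝ) : ℂ) * floorWave ξ y‖ ≤ 1 := by
    intro y hy hyY
    rw [norm_mul, Complex.norm_real, Real.norm_of_nonneg (by
      rw [sub_nonneg, div_le_one hY0]; exact hyY)]
    have : 0 ≤ y / Y := by positivity
    exact mul_le_one₀ (by linarith) (norm_nonneg _) (norm_floorWave_le _ _)
  set M := ⌊Y⌋₊ with hM
  have hMY : (M : ℝ) ≤ Y := Nat.floor_le hY0.le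
  have hYM : Y < M + 1 := Nat.lt_floor_add_one Y
  have hsplit : ∫ y in y₀..Y, ((1 - y / Y : ℝ) : ℂ) * floorWave ξ y =
      (∑ m ∈ Finset.range M, ∫ y in (m : ℝ)..(m + 1 : ℕ), ((1 - y / Y : ℝ) : ℂ) * floorWave ξ y) +
      (∫ y in (M : ℝ)..Y, ((1 - y / Y : ℝ) : ℂ) * floorWave ξ y) -
      ∫ y in (0 : ℝ)..y₀, ((1 - y / Y : ℝ) : ℂ) * floorWave ξ y := by
    have h2 := intervalIntegral.sum_integral_adjacent_intervals (μ := MeasureTheory.volume)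
      (f := fun y : ℝ => ((1 - y / Y : ℝ) : ℂ) * floorWave ξ y) (a := fun j : ℕ => (j : ℝ)) (n := M)
      (fun k _ => hint _ _)
    rw [Nat.cast_zero] at h2
    rw [h2, intervalIntegral.integral_add_adjacent_intervals (hint _ _) (hint _ _), eq_sub_iff_add_eq,
      add_comm, intervalIntegral.integral_add_adjacent_intervals (hint _ _) (hint _ _)]
  have hcell : ∀ m ∈ Finset.range M, ‖(∫ y in (m : ℝ)..(m + 1 : ℕ),
      ((1 - y / Y : ℝ) : ℂ) * floorWave ξ y) -
        (((1 - m / Y) / 2 : ℝ) : ℂ) * unitExp (ξ * m)‖ ≤ 1 / Y := by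
    intro m hm
    have h3 : (((1 - m / Y) / 2 : ℝ) : ℂ) * unitExp (ξ * m) =
        ∫ y in (m : ℝ)..(m + 1 : ℕ), ((1 - m / Y : ℝ) : ℂ) * floorWave ξ y := by
      rw [intervalIntegral.integral_const_mul, integral_floorWave]; push_cast; ring
    rw [h3, ← intervalIntegral.integral_sub (hint _ _)
      (((continuous_floorWave h0 h1).const_mul _).intervalIntegrable _ _)]
    have h4 := intervalIntegral.norm_integral_le_of_norm_le_const (a := (m : ℝ))
      (b := ((m + 1 : ℕ) : ℝ)) (C := 1 / Y)
      (f := fun y : ℝ => ((1 - y / Y : ℝ) : ℂ) * floorWave ξ y -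
        ((1 - m / Y : ℝ) : ℂ) * floorWave ξ y) (fun y hy => by
        rw [Set.uIoc_of_le (by push_cast; linarith)] at hy
        have hy2 := hy.2
        push_cast at hy2
        rw [← sub_mul, norm_mul, ← Complex.ofReal_sub, Complex.norm_real]
        have e : 1 - y / Y - (1 - m / Y) = -((y - m) / Y) := by ring
        have h5 : 0 ≤ (y - m) / Y := div_nonneg (by linarith [hy.1]) hY0.le
        rw [e, norm_neg, Real.norm_of_nonneg h5]
        calc (y - m) / Y * ‖floorWave ξ y‖ ≤ (y - m) / Y * 1 := by
              gcongr; exact norm_floorWave_le _ _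
          _ ≤ 1 / Y := by rw [mul_one]; gcongr; linarith)
    refine h4.trans_eq ?_
    push_cast
    rw [add_sub_cancel_left, abs_one, mul_one]
  have hcells : ‖∑ m ∈ Finset.range M, ((∫ y in (m : ℝ)..(m + 1 : ℕ),
      ((1 - y / Y : ℝ) : ℂ) * floorWave ξ y) -
        (((1 - m / Y) / 2 : ℝ) : ℂ) * unitExp (ξ * m))‖ ≤ 1 := by
    refine (norm_sum_le _ _).trans ((Finset.sum_le_sum hcell).trans ?_)
    rw [Finset.sum_const, Finset.card_range, nsmul_eq_mul, mul_one_div, div_le_one hY0]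
    exact hMY
  have hend : ‖∫ y in (M : ℝ)..Y, ((1 - y / Y : ℝ) : ℂ) * floorWave ξ y‖ ≤ 1 := by
    have := intervalIntegral.norm_integral_le_of_norm_le_const (a := (M : ℝ)) (b := Y) (C := 1)
      (f := fun y : ℝ => ((1 - y / Y : ℝ) : ℂ) * floorWave ξ y) (fun y hy => by
        rw [Set.uIoc_of_le hMY] at hy
        exact hnorm y ((Nat.cast_nonneg M).trans hy.1.le) hy.2)
    rw [one_mul, abs_of_nonneg (by linarith)] at this
    linarith
  have hstart : ‖∫ y in (0 : ℝ)..y₀, ((1 - y / Y : ℝ) : ℂ) * floorWave ξ y‖ ≤ y₀ := by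
    have := intervalIntegral.norm_integral_le_of_norm_le_const (a := 0) (b := y₀) (C := 1)
      (f := fun y : ℝ => ((1 - y / Y : ℝ) : ℂ) * floorWave ξ y) (fun y hy => by
        rw [Set.uIoc_of_le hy0] at hy
        exact hnorm y hy.1.le (hy.2.trans hyY))
    rwa [one_mul, sub_zero, abs_of_nonneg hy0] at this
  rw [hsplit]
  have e : ∀ A B C D : ℂ, A + B - C - D = (A - D) + B - C := fun A B C D => by ring
  rw [e, ← Finset.sum_sub_distrib]
  refine (norm_sub_le _ _).trans ?_
  have := norm_add_le (∑ m ∈ Finset.range M, ((∫ y in (m : ℝ)..(m + 1 : ℕ),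
      ((1 - y / Y : ℝ) : ℂ) * floorWave ξ y) -
        (((1 - m / Y) / 2 : ℝ) : ℂ) * unitExp (ξ * m)))
    (∫ y in (M : ℝ)..Y, ((1 - y / Y : ℝ) : ℂ) * floorWave ξ y)
  linarith

/-- One-sided bound for triangular cosine sums, possibly shifted by one. -/
theorem neg_le_sum_triangle_cos {Y : ℝ} (hY : 1 ≤ Y) (x : ℝ) {s : ℕ} (hs : s ≤ 1) :
    -(5 / 4) ≤ ∑ m ∈ Finset.range ⌊Y⌋₊, (1 - m / Y) / 2 * Real.cos ((m + s) * x) := by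
  have hY0 : 0 < Y := by linarith
  set M := ⌊Y⌋₊ with hM
  have hMY : (M : ℝ) ≤ Y := Nat.floor_le hY0.le
  have hYM : Y < M + 1 := Nat.lt_floor_add_one Y
  have hfej := fejer_nonneg M x
  have hcos : ∀ s : ℕ, -(M : ℝ) ≤ ∑ m ∈ Finset.range M, Real.cos ((m + s) * x) := by
    intro s
    have := Finset.sum_le_sum (s := Finset.range M) (f := fun _ => (-1 : ℝ))
      (g := fun m : ℕ => Real.cos ((m + s) * x)) (fun m _ => Real.neg_one_le_cos _)
    simpa using this
  have hfac : ∑ m ∈ Finset.range M, (1 - m / Y) / 2 * Real.cos ((m + s) * x) =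
      (∑ m ∈ Finset.range M, (Y - m) * Real.cos ((m + s) * x)) / (2 * Y) := by
    rw [Finset.sum_div]
    refine Finset.sum_congr rfl fun m _ => ?_
    field_simp
  rw [hfac, le_div_iff₀ (by positivity)]
  -- For s = 0 the sum contains half a Fejér kernel plus M/2, for s = 1 half a Fejér kernel minus
  -- M/2. The remaining cosines carry the coefficient Y - M ≤ 1, respectively Y - M + 1 ≤ 2. The
  -- worse case gives -5M/2, which after division by 2Y is at least -5/4.
  interval_cases s
  · have h1 : ∑ m ∈ Finset.range M, (Y - m) * Real.cos ((m + (0 : ℕ)) * x) =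
        (M + ∑ m ∈ Finset.range M, ((M : ℝ) - (m + 1)) * Real.cos ((m + 1) * x)) +
        (Y - M) * ∑ m ∈ Finset.range M, Real.cos ((m + (0 : ℕ)) * x) := by
      have h2 : ∑ m ∈ Finset.range (M + 1), ((M : ℝ) - m) * Real.cos (m * x) =
          M + ∑ m ∈ Finset.range M, ((M : ℝ) - (m + 1)) * Real.cos ((m + 1) * x) := by
        rw [Finset.sum_range_succ', add_comm]
        push_cast
        simp
      rw [← h2, Finset.sum_range_succ, sub_self, zero_mul, add_zero, Finset.mul_sum,
        ← Finset.sum_add_distrib]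
      refine Finset.sum_congr rfl fun m _ => ?_
      push_cast
      rw [add_zero]; ring
    rw [h1]
    have h3 := hcos 0
    generalize ∑ m ∈ Finset.range M, Real.cos ((m + (0 : ℕ)) * x) = B at h3 ⊢
    generalize ∑ m ∈ Finset.range M, ((M : ℝ) - (m + 1)) * Real.cos ((m + 1) * x) = A at hfej ⊢
    have hM0 : (0 : ℝ) ≤ M := Nat.cast_nonneg M
    have h4 : (Y - M) * -(M : ℝ) ≤ (Y - M) * B := mul_le_mul_of_nonneg_left h3 (by linarith)
    have h5 : (Y - M) * M ≤ 1 * M := mul_le_mul_of_nonneg_right (by linarith) hM0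
    linarith
  · have h1 : ∑ m ∈ Finset.range M, (Y - m) * Real.cos ((m + (1 : ℕ)) * x) =
        (∑ m ∈ Finset.range M, ((M : ℝ) - (m + 1)) * Real.cos ((m + 1) * x)) +
        (Y - M + 1) * ∑ m ∈ Finset.range M, Real.cos ((m + (1 : ℕ)) * x) := by
      rw [Finset.mul_sum, ← Finset.sum_add_distrib]
      refine Finset.sum_congr rfl fun m _ => ?_
      push_cast; ring
    rw [h1]
    have h3 := hcos 1
    generalize ∑ m ∈ Finset.range M, Real.cos ((m + (1 : ℕ)) * x) = B at h3 ⊢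
    generalize ∑ m ∈ Finset.range M, ((M : ℝ) - (m + 1)) * Real.cos ((m + 1) * x) = A at hfej ⊢
    have hM0 : (0 : ℝ) ≤ M := Nat.cast_nonneg M
    have h4 : (Y - M + 1) * -(M : ℝ) ≤ (Y - M + 1) * B := mul_le_mul_of_nonneg_left h3 (by linarith)
    have h5 : (Y - M + 1) * M ≤ 2 * M := mul_le_mul_of_nonneg_right (by linarith) hM0
    linarith

theorem le_sum_triangle {Y : ℝ} (hY : 1 ≤ Y) :
    Y / 4 ≤ ∑ m ∈ Finset.range ⌊Y⌋₊, (1 - m / Y) / 2 := by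
  have hY0 : 0 < Y := by linarith
  set M := ⌊Y⌋₊ with hM
  have hMY : (M : ℝ) ≤ Y := Nat.floor_le hY0.le
  have hYM : Y < M + 1 := Nat.lt_floor_add_one Y
  have hg : (∑ m ∈ Finset.range M, (m : ℝ)) * 2 = M * (M - 1) := by
    have h1 : 1 ≤ M := Nat.one_le_floor_iff _ |>.2 hY
    have := Finset.sum_range_id_mul_two M
    have h2 : ((∑ m ∈ Finset.range M, m : ℕ) : ℝ) * 2 = M * ((M - 1 : ℕ) : ℝ) := by
      exact_mod_cast this
    rwa [Nat.cast_sum, Nat.cast_sub h1, Nat.cast_one] at h2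
  rw [← Finset.sum_div, Finset.sum_sub_distrib, ← Finset.sum_div]
  simp only [Finset.sum_const, Finset.card_range, nsmul_eq_mul, mul_one]
  rw [eq_div_of_mul_eq two_ne_zero hg]
  have : (M : ℝ) * (M - 1) / 2 / Y ≤ (M - 1) / 2 := by
    rw [div_le_iff₀ hY0]
    have h1 : (1 : ℝ) ≤ M := by exact_mod_cast (Nat.one_le_floor_iff _ |>.2 hY)
    nlinarith
  linarith

/-! ### Comparison of floor sums with triangular averages. -/

namespace HasConvexGrowth

variable {f f₁ f₂ : ℝ → ℝ} {κ t₀ : ℝ}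

/-- The factor f' in the weight is the Jacobian of y = f(t), which is why the weight was chosen. -/
theorem integral_weight_mul (hf : HasConvexGrowth f f₁ f₂ κ t₀) {ξ a X : ℝ} (h0 : 0 ≤ ξ)
    (h1 : ξ < 1) (ha : t₀ ≤ a) (haX : a ≤ X) :
    ∫ t in a..X, (growthWeight f f₁ X t : ℂ) * floorWave ξ (f t) =
      ∫ y in f a..f X, ((1 - y / f X : ℝ) : ℂ) * floorWave ξ y := by
  have hsub : Set.uIcc a X ⊆ Set.Ici t₀ := by
    rw [Set.uIcc_of_le haX]; exact fun t ht => ha.trans ht.1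
  have hcont : Continuous fun y : ℝ => ((1 - y / f X : ℝ) : ℂ) * floorWave ξ y := by
    have := continuous_floorWave h0 h1
    have h2 : Continuous fun y : ℝ => ((1 - y / f X : ℝ) : ℂ) := by fun_prop
    exact h2.mul this
  rw [← intervalIntegral.integral_deriv_smul_comp (fun x hx => hf.hasDerivAt x (hsub hx))
    (hf.continuousOn_deriv.mono hsub) hcont]
  refine intervalIntegral.integral_congr fun t _ => ?_
  simp only [growthWeight, Function.comp, Complex.real_smul]
  push_cast; ring

/-- Sums of `floorWave` along a function of convex growth are close to integrals. -/
theorem exists_norm_sum_floorWave_sub_integral_le (hf : HasConvexGrowth f f₁ f₂ κ t₀) :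
    ∃ C : ℝ, 0 < C ∧ ∀ r : ℕ, 2 ≤ r → 2 * t₀ ≤ r → ∀ ξ : ℝ, 0 ≤ ξ → ξ < 1 →
      ‖∑ n ∈ Finset.Ico (r ^ 2) (r ^ 5), (growthWeight f f₁ (r ^ 5) n : ℂ) * floorWave ξ (f n) -
        ∫ t in (r ^ 2 : ℝ)..(r ^ 5), (growthWeight f f₁ (r ^ 5) t : ℂ) * floorWave ξ (f t)‖ ≤
      C * (r ^ 4 * f₁ (r ^ 5) ^ 2) := by
  obtain ⟨C, hC, hmain⟩ := hf.exists_norm_sum_wave_sub_integral_le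
  have hB : 0 ≤ ∑' k, floorWaveBound k := tsum_nonneg floorWaveBound_nonneg
  refine ⟨C * (∑' k, floorWaveBound k + 1), by positivity, fun r hr hrt ξ h0 h1 => ?_⟩
  have hr1 : (2 : ℝ) ≤ r := by exact_mod_cast hr
  have hrX : (r : ℝ) ^ 2 ≤ r ^ 5 := pow_le_pow_right₀ (by linarith) (by norm_num)
  have hrL : t₀ ≤ (r : ℝ) ^ 2 := by nlinarith [hf.one_le_start]
  set X : ℝ := (r : ℝ) ^ 5 with hX
  have hsub : Set.uIcc ((r : ℝ) ^ 2) X ⊆ Set.Ici t₀ := by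
    rw [Set.uIcc_of_le hrX]; exact fun t ht => hrL.trans ht.1
  have hterm : ∀ (k : ℤ) (t : ℝ), floorWaveCoeff (ξ + k) * wave f f₁ X (ξ + k) t =
      (growthWeight f f₁ X t : ℂ) * (floorWaveCoeff (ξ + k) * unitExp ((ξ + k) * f t)) :=
    fun k t => by rw [wave]; ring
  have hpoint : ∀ t : ℝ, HasSum (fun k : ℤ => floorWaveCoeff (ξ + k) * wave f f₁ X (ξ + k) t)
      ((growthWeight f f₁ X t : ℂ) * floorWave ξ (f t)) := fun t => by
    simp_rw [hterm]
    exact (hasSum_floorWave h0 h1 (f t)).mul_left _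
  have hint : HasSum (fun k : ℤ => ∫ t in (r ^ 2 : ℝ)..X,
        floorWaveCoeff (ξ + k) * wave f f₁ X (ξ + k) t)
      (∫ t in (r ^ 2 : ℝ)..X, (growthWeight f f₁ X t : ℂ) * floorWave ξ (f t)) := by
    refine intervalIntegral.hasSum_integral_of_dominated_convergence
      (fun k _ => ‖floorWaveCoeff (ξ + k)‖ * f₁ X) (fun k => ?_) (fun k => ?_) ?_ ?_ ?_
    · exact (ContinuousOn.const_mul ((hf.continuousOn_wave X (ξ + k)).mono
        (Set.uIoc_subset_uIcc.trans hsub)) _).aestronglyMeasurable measurableSet_uIoc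
    · refine Eventually.of_forall fun t ht => ?_
      rw [Set.uIoc_of_le hrX] at ht
      have ht0 : t₀ ≤ t := hrL.trans ht.1.le
      rw [norm_mul, wave, norm_mul, norm_unitExp, mul_one, Complex.norm_real,
        Real.norm_of_nonneg (hf.weight_nonneg ht0 ht.2)]
      exact mul_le_mul_of_nonneg_left (hf.weight_le ht0 ht.2) (norm_nonneg _)
    · exact Eventually.of_forall fun t _ => (summable_norm_floorWaveCoeff h0 h1).mul_right _
    · exact intervalIntegrable_const
    · exact Eventually.of_forall fun t _ => hpoint t
  have hsum := hasSum_sum (s := Finset.Ico (r ^ 2) (r ^ 5)) (fun n _ => hpoint (n : ℝ))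
  have htot := hsum.sub hint
  -- The expansion is superposed termwise: the error at frequency ξ + k grows like 1 + |ξ + k|,
  -- which the coefficients absorb.
  refine htot.norm_le_of_bounded
    (((summable_floorWaveBound.hasSum).mul_left C).mul_right (r ^ 4 * f₁ X ^ 2)) (fun k => ?_)
    |>.trans ?_
  · rw [intervalIntegral.integral_const_mul, ← Finset.mul_sum, ← mul_sub, norm_mul]
    calc _ ≤ ‖floorWaveCoeff (ξ + k)‖ * (C * (1 + |ξ + k|) * (r ^ 4 * f₁ X ^ 2)) :=
          mul_le_mul_of_nonneg_left (hmain r hr hrt _) (norm_nonneg _)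
      _ = C * (‖floorWaveCoeff (ξ + k)‖ * (1 + |ξ + k|)) * (r ^ 4 * f₁ X ^ 2) := by ring
      _ ≤ C * floorWaveBound k * (r ^ 4 * f₁ X ^ 2) := by
          gcongr
          exact norm_floorWaveCoeff_mul_le_bound h0 h1 k
  · gcongr
    linarith

end HasConvexGrowth

/-! ### Construction of the cosine polynomial. -/

namespace HasConvexGrowth

variable {f f₁ f₂ : ℝ → ℝ} {κ t₀ : ℝ}

/-- The Van der Corput quantity of a set containing the integer parts of a function of convex
growth, rounded down (`s = 0`) or up (`s = 1`). -/
theorem exists_vdcQuantity_le (hf : HasConvexGrowth f f₁ f₂ κ t₀) {S : Set ℤ} {s : ℕ} (hs : s ≤ 1)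
    (hS : ∀ n : ℕ, t₀ ≤ n → f n = ⌊f n⌋ ∨ ⌊f n⌋ + (s : ℤ) ∈ S) :
    ∃ C : ℝ, 0 < C ∧ ∀ r N : ℕ, 2 ≤ r → 2 * t₀ ≤ r → f (r ^ 5) ≤ N →
      vdcQuantity S N ≤ C * (f₁ (r ^ 5) / r) := by
  obtain ⟨C, hC, hmain⟩ := hf.exists_norm_sum_floorWave_sub_integral_le
  have ht1 := hf.one_le_start
  have hft := hf.one_le t₀ le_rfl
  refine ⟨16 * (C + f t₀ + 5), by positivity, fun r N hr hrt hN => ?_⟩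
  have hr1 : (2 : ℝ) ≤ r := by exact_mod_cast hr
  have hr0 : (0 : ℝ) < r := by linarith
  have hrX : (r : ℝ) ^ 2 ≤ r ^ 5 := pow_le_pow_right₀ (by linarith) (by norm_num)
  have hrL : t₀ ≤ (r : ℝ) ^ 2 := by nlinarith
  have hrX2 : 2 * t₀ ≤ (r : ℝ) ^ 5 := hrt.trans (le_self_pow₀ (by linarith) (by norm_num))
  specialize hmain r hr hrt
  set X : ℝ := (r : ℝ) ^ 5 with hX
  have hXt : t₀ ≤ X := by linarith
  have hYD := hf.mul_deriv_le hrX2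
  have hD1 := hf.one_le_deriv X hXt
  have hY1 := hf.one_le X hXt
  set D := f₁ X with hD
  set Y := f X with hY
  have hY0 : 0 < Y := by linarith
  have hy0 := hf.one_le _ hrL
  have hyY : f (r ^ 2) ≤ Y := hf.monotoneOn hrL hXt hrX
  have hyle : f (r ^ 2) ≤ f t₀ + r ^ 2 * D := by
    refine (hf.le_add_mul_deriv hrL).trans ?_
    have := hf.monotoneOn_deriv hrL hXt hrX
    gcongr
  set I := Finset.Ico (r ^ 2) (r ^ 5) with hI
  have hImem : ∀ n ∈ I, t₀ ≤ (n : ℝ) ∧ (n : ℝ) < X := fun n hn => by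
    have h1 := Finset.mem_Ico.1 hn
    have h2 : (r : ℝ) ^ 2 ≤ n := by exact_mod_cast h1.1
    have h3 : (n : ℝ) < X := by rw [hX]; exact_mod_cast h1.2
    exact ⟨hrL.trans h2, h3⟩
  set E₀ : ℝ := C * (r ^ 4 * D ^ 2) + (f (r ^ 2) + 2) with hE₀
  have hcompare : ∀ ξ : ℝ, 0 ≤ ξ → ξ < 1 →
      ‖∑ n ∈ I, (growthWeight f f₁ X n : ℂ) * floorWave ξ (f n) -
        ∑ m ∈ Finset.range ⌊Y⌋₊, (((1 - m / Y) / 2 : ℝ) : ℂ) * unitExp (ξ * m)‖ ≤ E₀ := by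
    intro ξ h0 h1
    have h2 := hmain ξ h0 h1
    rw [hf.integral_weight_mul h0 h1 hrL hrX] at h2
    have h3 := norm_integral_floorWave_sub_sum_le h0 h1 (by linarith) hyY hY1
    exact (norm_sub_le_norm_sub_add_norm_sub _ _ _).trans (add_le_add h2 h3)
  -- The coefficient vanishes when f(n) is an integer, exactly the case in which ⌊f(n)⌋ + 1 need not
  -- be the ceiling. This permits the shift s = 1.
  set v : ℕ → ℝ := fun n => growthWeight f f₁ X n * Real.sin (Real.pi * f n) ^ 2 with hv
  set m : ℕ → ℕ := fun n => ⌊f n⌋₊ + s with hm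
  have hmcast : ∀ n ∈ I, (m n : ℤ) = ⌊f n⌋ + (s : ℤ) := fun n hn => by
    have := hf.one_le n (hImem n hn).1
    simp only [hm]
    push_cast
    rw [Int.natCast_floor_eq_floor (by linarith)]
  have hre : ∀ ξ : ℝ, (unitExp (ξ * s) * ∑ n ∈ I, (growthWeight f f₁ X n : ℂ) *
      floorWave ξ (f n)).re = ∑ n ∈ I, v n * Real.cos (2 * Real.pi * m n * ξ) := by
    intro ξ
    rw [Finset.mul_sum, Complex.re_sum]
    refine Finset.sum_congr rfl fun n hn => ?_
    have e : unitExp (ξ * s) * ((growthWeight f f₁ X n : ℂ) * floorWave ξ (f n)) =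
        ((v n : ℝ) : ℂ) * unitExp (m n * ξ) := by
      have h1 : (m n : ℝ) * ξ = ξ * s + ξ * ⌊f n⌋ := by
        have : (m n : ℝ) = ⌊f n⌋ + s := by exact_mod_cast congrArg (Int.cast : ℤ → ℝ) (hmcast n hn)
        rw [this]; ring
      rw [h1, unitExp_add, floorWave, hv]
      push_cast; ring
    rw [e, Complex.re_ofReal_mul, unitExp_re]
    ring_nf
  have hre2 : ∀ ξ : ℝ, (unitExp (ξ * s) * ∑ m ∈ Finset.range ⌊Y⌋₊,
      (((1 - m / Y) / 2 : ℝ) : ℂ) * unitExp (ξ * m)).re =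
      ∑ m ∈ Finset.range ⌊Y⌋₊, (1 - m / Y) / 2 * Real.cos ((m + s) * (2 * Real.pi * ξ)) := by
    intro ξ
    rw [Finset.mul_sum, Complex.re_sum]
    refine Finset.sum_congr rfl fun k _ => ?_
    rw [mul_left_comm, ← unitExp_add, Complex.re_ofReal_mul, unitExp_re]
    ring_nf
  have hdiff : ∀ ξ : ℝ, 0 ≤ ξ → ξ < 1 →
      ∑ m ∈ Finset.range ⌊Y⌋₊, (1 - m / Y) / 2 * Real.cos ((m + s) * (2 * Real.pi * ξ)) - E₀ ≤
        ∑ n ∈ I, v n * Real.cos (2 * Real.pi * m n * ξ) := by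
    intro ξ h0 h1
    have h2 := hcompare ξ h0 h1
    have h3 := Complex.abs_re_le_norm (unitExp (ξ * s) * (∑ n ∈ I, (growthWeight f f₁ X n : ℂ) *
      floorWave ξ (f n) - ∑ m ∈ Finset.range ⌊Y⌋₊,
        (((1 - m / Y) / 2 : ℝ) : ℂ) * unitExp (ξ * m)))
    rw [norm_mul, norm_unitExp, one_mul, mul_sub, Complex.sub_re, hre, hre2] at h3
    have := (abs_le.1 (h3.trans h2)).1
    linarith
  have hW : Y / 4 - E₀ ≤ ∑ n ∈ I, v n := by
    have h1 := hdiff 0 le_rfl zero_lt_one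
    simp only [mul_zero, Real.cos_zero, mul_one] at h1
    linarith [le_sum_triangle hY1]
  have hge : ∀ ξ : ℝ, -(E₀ + 5 / 4) ≤ ∑ n ∈ I, v n * Real.cos (2 * Real.pi * m n * ξ) := by
    intro ξ
    -- The comparison is available for 0 ≤ ξ < 1 only; the integer frequencies make the sum
    -- 1-periodic.
    have h1 := hdiff (Int.fract ξ) (Int.fract_nonneg ξ) (Int.fract_lt_one ξ)
    have h2 := neg_le_sum_triangle_cos hY1 (2 * Real.pi * Int.fract ξ) hs
    have h3 : ∀ n ∈ I, v n * Real.cos (2 * Real.pi * m n * ξ) =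
        v n * Real.cos (2 * Real.pi * m n * Int.fract ξ) := fun n _ => by
      have h4 := congrArg Complex.re (unitExp_int_mul_fract (m n) ξ)
      rw [unitExp_re, unitExp_re] at h4
      push_cast at h4
      rw [mul_assoc (2 * Real.pi), mul_assoc (2 * Real.pi), h4]
    rw [Finset.sum_congr rfl h3]
    linarith
  have hE0 : 0 < E₀ := by positivity
  have hpos : Y / 4 ≤ ∑ n ∈ I, v n + (E₀ + 5 / 4) := by linarith
  have hvdc := vdcQuantity_le_of_sum_cos_ge (S := S) (N := N) (I := I) (v := v) (m := m)
    (E := E₀ + 5 / 4)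
    (fun n hn => by
      have h1 := hImem n hn
      have hfn := hf.one_le n h1.1
      have h2 : 1 ≤ ⌊f n⌋₊ := (Nat.one_le_floor_iff _).2 hfn
      have h3 : ⌊f n⌋₊ < N := by
        rw [Nat.floor_lt (by linarith)]
        refine lt_of_lt_of_le ?_ hN
        -- As f' ≥ 1 and n < X, the inequality f(n) < f(X) ≤ N is strict, which leaves room for the
        -- shift s ≤ 1.
        have h4 := mul_sub_le_sub_of_hasDerivAt (t₀ := t₀) (g := f) (g' := f₁) (C := 1)
          h1.2.le h1.1 hf.hasDerivAt (fun t ht _ => hf.one_le_deriv t (h1.1.trans ht))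
        linarith [h1.2]
      simp only [hm]; omega)
    (fun n hn => by
      rcases hS n (hImem n hn).1 with h | h
      · left
        simp only [hv]
        rw [h, mul_comm Real.pi, Real.sin_int_mul_pi]; ring
      · right; rw [hmcast n hn]; exact h)
    hge (by linarith)
  refine hvdc.trans ?_
  have hr2 : (r : ℝ) ^ 2 ≤ r ^ 4 := pow_le_pow_right₀ (by linarith) (by norm_num)
  have hDD : D ≤ D ^ 2 := by nlinarith
  have hone : (1 : ℝ) ≤ r ^ 4 * D ^ 2 :=
    one_le_mul_of_one_le_of_one_le (one_le_pow₀ (by linarith)) (one_le_pow₀ hD1)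
  have hE : E₀ + 5 / 4 ≤ (C + f t₀ + 5) * (r ^ 4 * D ^ 2) := by
    have h1 : (r : ℝ) ^ 2 * D ≤ r ^ 4 * D ^ 2 := by gcongr
    have h2 : f t₀ * 1 ≤ f t₀ * (r ^ 4 * D ^ 2) := by gcongr
    rw [hE₀]
    linarith
  have hD0 : 0 < D := by linarith
  calc (E₀ + 5 / 4) / (∑ n ∈ I, v n + (E₀ + 5 / 4)) ≤ (E₀ + 5 / 4) / (X * D / 16) := by
        gcongr; linarith
    _ ≤ (C + f t₀ + 5) * (r ^ 4 * D ^ 2) / (X * D / 16) := by gcongr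
    _ = 16 * (C + f t₀ + 5) * (D / r) := by rw [hX]; field_simp

end HasConvexGrowth

/-! ### Exponents and the theorem. -/

/-- Continuity at δ = 0, where the quotient equals 6/(5c) - 1. -/
theorem exists_exponent_loss {c ε : ℝ} (hc1 : 1 < c) (hc2 : c < 6 / 5) (hε : 0 < ε) :
    ∃ δ : ℝ, 0 < δ ∧ 0 < 6 - 5 * c - 5 * δ ∧
      -((6 - 5 * c - 5 * δ) / (5 * (c + δ))) ≤ -(6 / (5 * c) - 1) + ε := by
  have hc0 : 0 < c := by linarith
  have hcont : ContinuousAt (fun δ : ℝ => (6 - 5 * c - 5 * δ) / (5 * (c + δ))) 0 := by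
    refine ContinuousAt.div (by fun_prop) (by fun_prop) ?_
    simpa using hc0.ne'
  have hval : (6 - 5 * c - 5 * 0) / (5 * (c + 0)) = 6 / (5 * c) - 1 := by field_simp; ring
  have h1 : ∀ᶠ δ in nhds (0 : ℝ), 6 / (5 * c) - 1 - ε < (6 - 5 * c - 5 * δ) / (5 * (c + δ)) := by
    refine hcont.eventually (lt_mem_nhds ?_)
    show 6 / (5 * c) - 1 - ε < (6 - 5 * c - 5 * 0) / (5 * (c + 0))
    rw [hval]; linarith
  have h2 : ∀ᶠ δ in nhds (0 : ℝ), δ < (6 - 5 * c) / 5 := gt_mem_nhds (by linarith)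
  obtain ⟨δ, ⟨h3, h4⟩, h5⟩ := (((h1.and h2).filter_mono nhdsWithin_le_nhds).and
    (self_mem_nhdsWithin : Set.Ioi (0 : ℝ) ∈ nhdsWithin 0 (Set.Ioi 0))).exists
  exact ⟨δ, h5, by linarith, by linarith⟩

namespace HasConvexGrowth

variable {f f₁ f₂ : ℝ → ℝ} {κ t₀ : ℝ}

theorem exists_nat_between (hf : HasConvexGrowth f f₁ f₂ κ t₀) {R N : ℕ}
    (hR : 2 * t₀ ≤ R) (hN : f (R ^ 5) ≤ N) :
    ∃ r : ℕ, R ≤ r ∧ f (r ^ 5) ≤ N ∧ (N : ℝ) < f (((r + 1 : ℕ) : ℝ) ^ 5) := by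
  classical
  have ht1 := hf.one_le_start
  have hex : ∃ r : ℕ, R ≤ r ∧ (N : ℝ) < f (((r + 1 : ℕ) : ℝ) ^ 5) := by
    -- Since f(t) ≥ t f'(t)/4 ≥ t/4 for t ≥ 2t₀, an argument above 4N suffices.
    refine ⟨R + 4 * N, by omega, ?_⟩
    set x : ℝ := ((R + 4 * N + 1 : ℕ) : ℝ) with hx
    have hx1 : (R : ℝ) + 4 * N + 1 = x := by rw [hx]; push_cast; ring
    have hN0 : (0 : ℝ) ≤ N := Nat.cast_nonneg N
    have hxx : x ≤ x ^ 5 := le_self_pow₀ (by linarith) (by norm_num)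
    have h1 := hf.mul_deriv_le (X := x ^ 5) (by linarith)
    have h2 := hf.one_le_deriv (x ^ 5) (by linarith)
    nlinarith
  have hspec := Nat.find_spec hex
  refine ⟨Nat.find hex, hspec.1, ?_, hspec.2⟩
  rcases hspec.1.eq_or_lt with h | h
  · rw [← h]; exact hN
  · have hmin := Nat.find_min hex (m := Nat.find hex - 1) (by omega)
    rw [not_and, not_lt, Nat.sub_add_cancel (by omega)] at hmin
    exact hmin (by omega)

theorem exists_vdcQuantity_le_rpow (hf : HasConvexGrowth f f₁ f₂ κ t₀) {S : Set ℤ} {s : ℕ}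
    (hs : s ≤ 1) (hS : ∀ n : ℕ, t₀ ≤ n → f n = ⌊f n⌋ ∨ ⌊f n⌋ + (s : ℤ) ∈ S) {c δ : ℝ}
    (hc : 0 < c) (hδ : 0 < δ) (hcδ : 0 < 6 - 5 * c - 5 * δ)
    (hub : ∀ᶠ t : ℝ in atTop, f t ≤ t ^ (c + δ))
    (hub₁ : ∀ᶠ t : ℝ in atTop, f₁ t ≤ t ^ (c - 1 + δ)) :
    ∃ C : ℝ, 0 < C ∧ ∀ N : ℕ, 1 ≤ N →
      vdcQuantity S N ≤ C * (N : ℝ) ^ (-((6 - 5 * c - 5 * δ) / (5 * (c + δ)))) := by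
  obtain ⟨C, hC, hmain⟩ := hf.exists_vdcQuantity_le hs hS
  obtain ⟨T, hT⟩ := eventually_atTop.1 (hub.and hub₁)
  set μ := 6 - 5 * c - 5 * δ with hμ
  set ν := 5 * (c + δ) with hν
  have hν0 : 0 < ν := by positivity
  set R : ℕ := ⌈max T (2 * t₀)⌉₊ + 2 with hR
  have hRle : max T (2 * t₀) ≤ (R : ℝ) := by
    rw [hR]; push_cast
    linarith [Nat.le_ceil (max T (2 * t₀))]
  have hlarge : ∀ r : ℕ, R ≤ r → T ≤ (r : ℝ) ^ 5 ∧ 2 * t₀ ≤ r ∧ 2 ≤ r := by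
    intro r hr
    have h1 : (R : ℝ) ≤ r := by exact_mod_cast hr
    have h2 : 2 ≤ r := by omega
    have h3 : (2 : ℝ) ≤ r := by exact_mod_cast h2
    have h4 : (r : ℝ) ≤ r ^ 5 := le_self_pow₀ (by linarith) (by norm_num)
    exact ⟨by linarith [le_max_left T (2 * t₀)], by linarith [le_max_right T (2 * t₀)], h2⟩
  have hpow : ∀ (r : ℕ) (x : ℝ), ((r : ℝ) ^ 5) ^ x = (r : ℝ) ^ (5 * x) := by
    intro r x
    rw [← Real.rpow_natCast, ← Real.rpow_mul (Nat.cast_nonneg r)]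
    norm_num
  have hN₀ : 1 ≤ f (R ^ 5) := by
    have := hlarge R le_rfl
    have h3 : (2 : ℝ) ≤ R := by exact_mod_cast this.2.2
    have h4 : (R : ℝ) ≤ R ^ 5 := le_self_pow₀ (by linarith) (by norm_num)
    exact hf.one_le _ (by linarith [hf.one_le_start])
  -- The first summand serves large N: f'(r⁵)/r ≤ r^(-μ), while N < f((r+1)⁵) ≤ (r+1)^ν with r + 1 ≤
  -- 2r. The second makes the bound at least 1 when N < f(R⁵), where the trivial estimate is enough.
  refine ⟨C * 2 ^ μ + f (R ^ 5) ^ (μ / ν), by positivity, fun N hN => ?_⟩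
  have hN1 : (1 : ℝ) ≤ N := by exact_mod_cast hN
  have hN0 : (0 : ℝ) < N := by linarith
  have hNpos : 0 < (N : ℝ) ^ (-(μ / ν)) := Real.rpow_pos_of_pos hN0 _
  rw [add_mul]
  rcases lt_or_ge (N : ℝ) (f (R ^ 5)) with hsmall | hbig
  · have h1 : 1 ≤ f (R ^ 5) ^ (μ / ν) * (N : ℝ) ^ (-(μ / ν)) := by
      rw [Real.rpow_neg hN0.le, ← div_eq_mul_inv, one_le_div (Real.rpow_pos_of_pos hN0 _)]
      exact Real.rpow_le_rpow hN0.le hsmall.le (by positivity)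
    have h2 : 0 ≤ C * 2 ^ μ * (N : ℝ) ^ (-(μ / ν)) := by positivity
    linarith [vdcQuantity_le_one S N]
  · obtain ⟨r, hRr, hr1, hr2⟩ := hf.exists_nat_between (hlarge R le_rfl).2.1 hbig
    have hr := hlarge r hRr
    have hr' := hlarge (r + 1) (by omega)
    have hr0 : (2 : ℝ) ≤ r := by exact_mod_cast hr.2.2
    have hrpos : (0 : ℝ) < r := by linarith
    have h3 : f₁ (r ^ 5) / r ≤ (r : ℝ) ^ (-μ) := by
      have h4 := (hT _ hr.1).2
      rw [hpow] at h4
      have h5 : (r : ℝ) ^ (-μ) = (r : ℝ) ^ (5 * (c - 1 + δ)) / r := by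
        rw [← Real.rpow_sub_one hrpos.ne']
        congr 1; rw [hμ]; ring
      rw [h5]
      gcongr
    have h6 : (N : ℝ) ^ ν⁻¹ ≤ 2 * r := by
      have h7 := hr2.le.trans (hT _ hr'.1).1
      rw [hpow, ← hν] at h7
      calc (N : ℝ) ^ ν⁻¹ ≤ (((r + 1 : ℕ) : ℝ) ^ ν) ^ ν⁻¹ :=
            Real.rpow_le_rpow hN0.le h7 (by positivity)
        _ = ((r + 1 : ℕ) : ℝ) := Real.rpow_rpow_inv (Nat.cast_nonneg _) hν0.ne'
        _ ≤ 2 * r := by push_cast; linarith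
    have h8 : (r : ℝ) ^ (-μ) ≤ 2 ^ μ * (N : ℝ) ^ (-(μ / ν)) := by
      have h9 : ((2 : ℝ) * r) ^ (-μ) ≤ ((N : ℝ) ^ ν⁻¹) ^ (-μ) :=
        Real.rpow_le_rpow_of_nonpos (Real.rpow_pos_of_pos hN0 _) h6 (by linarith)
      rw [← Real.rpow_mul hN0.le, Real.mul_rpow two_pos.le hrpos.le, Real.rpow_neg two_pos.le,
        inv_mul_eq_div, div_le_iff₀ (by positivity)] at h9
      rw [show -(μ / ν) = ν⁻¹ * -μ by ring, mul_comm]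
      exact h9
    have h10 : 0 ≤ f (R ^ 5) ^ (μ / ν) * (N : ℝ) ^ (-(μ / ν)) := by positivity
    calc vdcQuantity S N ≤ C * (f₁ (r ^ 5) / r) := hmain r N hr.2.2 hr.2.1 hr1
      _ ≤ C * (2 ^ μ * (N : ℝ) ^ (-(μ / ν))) := by gcongr; exact h3.trans h8
      _ ≤ _ := by linarith

end HasConvexGrowth

theorem exists_vdcQuantity_floorSet_le {u : WithBot ℝ} {h : ℝ → ℝ} {c : ℝ}
    (hh : IsHardyFieldFunction u h) (hgrowth : HasGrowthRate h c)
    (hc1 : 1 < c) (hc2 : c < 6 / 5) {ε : ℝ} (hε : 0 < ε) :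
    ∃ C : ℝ, 0 < C ∧ ∀ N : ℕ, 1 ≤ N →
      vdcQuantity (floorSet u h) N ≤ C * (N : ℝ) ^ (-(6 / (5 * c) - 1) + ε) := by
  obtain ⟨δ, hδ, hcδ, hle⟩ := exists_exponent_loss hc1 hc2 hε
  obtain ⟨f, hfh, hub, hub₁, κ, t₀, hf, hu⟩ :=
    hh.exists_hasConvexGrowth hgrowth hc1 (by linarith)
  have hS : ∃ s : ℕ, s ≤ 1 ∧ ∀ n : ℕ, t₀ ≤ n →
      f n = ⌊f n⌋ ∨ ⌊f n⌋ + (s : ℤ) ∈ floorSet u h := by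
    -- If h is eventually negative, then f = -h and -⌊h(n)⌋ = ⌈f(n)⌉, which is ⌊f(n)⌋ + 1 unless
    -- f(n) is an integer; hence s = 1.
    rcases hfh with rfl | rfl
    · exact ⟨0, zero_le_one, fun n hn => Or.inr ⟨n, hu n hn, Or.inl (by simp)⟩⟩
    · refine ⟨1, le_rfl, fun n hn => ?_⟩
      by_cases hint : -h n = ⌊-h n⌋
      · exact Or.inl hint
      · refine Or.inr ⟨n, hu n hn, Or.inr ?_⟩
        rw [← Int.ceil_neg, eq_comm, Int.ceil_eq_iff]
        push_cast
        exact ⟨by linarith [lt_of_le_of_ne (Int.floor_le (-h n)) (Ne.symm hint)],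
          (Int.lt_floor_add_one _).le⟩
  obtain ⟨s, hs, hS⟩ := hS
  obtain ⟨C, hC, hmain⟩ := hf.exists_vdcQuantity_le_rpow hs hS (by linarith) hδ hcδ
    (hub δ hδ) (hub₁ δ hδ)
  refine ⟨C, hC, fun N hN => (hmain N hN).trans ?_⟩
  have hN1 : (1 : ℝ) ≤ N := by exact_mod_cast hN
  gcongr

theorem mainTheorem1 (u : WithBot ℝ) (h : ℝ → ℝ) (c : ℝ)
    (hh : IsHardyFieldFunction u h) (hgrowth : HasGrowthRate h c)
    (hc1 : 1 < c) (hc2 : c < 6 / 5) :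
    (∀ ε : ℝ, 0 < ε → ∃ C : ℝ, 0 < C ∧ ∀ N : ℕ, 1 ≤ N →
      vdcQuantity (floorSet u h) N ≤ C * (N : ℝ) ^ (-(6 / (5 * c) - 1) + ε)) ∧
    (∀ ε : ℝ, 0 < ε → ∃ C : ℝ, 0 < C ∧ ∀ N : ℕ, 1 ≤ N →
      ∀ A : Finset ℤ, A ⊆ Finset.Icc 1 (N : ℤ) →
        (∀ n : ℕ, u < ((n : ℝ) : WithBot ℝ) → ⌊h n⌋ ≠ 0 →
          ∀ x ∈ A, x + ⌊h n⌋ ∉ A ∧ x - ⌊h n⌋ ∉ A) →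
        (A.card : ℝ) ≤ C * (N : ℝ) ^ (1 - (6 / (5 * c) - 1) + ε)) := by
  refine ⟨fun ε hε => exists_vdcQuantity_floorSet_le hh hgrowth hc1 hc2 hε, fun ε hε => ?_⟩
  obtain ⟨C, hC, hmain⟩ := exists_vdcQuantity_floorSet_le hh hgrowth hc1 hc2 hε
  refine ⟨2 * C, by positivity, fun N hN A hA hdiff => ?_⟩
  have hN0 : (0 : ℝ) < N := by exact_mod_cast hN
  have hcard := card_le_two_mul_vdcQuantity (S := floorSet u h) hN hA (by
    rintro k ⟨n, hn, rfl | rfl⟩ hk x hx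
    · exact hdiff n hn (by omega) x hx
    · have := hdiff n hn (by omega) x hx
      rw [← sub_eq_add_neg, sub_neg_eq_add]
      exact ⟨this.2, this.1⟩)
  calc (A.card : ℝ) ≤ 2 * N * vdcQuantity (floorSet u h) N := hcard
    _ ≤ 2 * N * (C * (N : ℝ) ^ (-(6 / (5 * c) - 1) + ε)) := by
        gcongr; exact hmain N hN
    _ = 2 * C * ((N : ℝ) ^ (1 : ℝ) * (N : ℝ) ^ (-(6 / (5 * c) - 1) + ε)) := by
        rw [Real.rpow_one]; ring
    _ = 2 * C * (N : ℝ) ^ (1 - (6 / (5 * c) - 1) + ε) := by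
        rw [← Real.rpow_add hN0]; ring_nf
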